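/- All graphs are finite, undirected and without loops or multiple edges. For a graph $H$, a set $D\subseteq V(H)$ is dominating if every vertex of $H$ lies in $D$ or has a neighbour in $D$. Let $\gamma(H)$ be the minimum cardinality of a dominating set of $H$, and let $i(H)$ be the minimum cardinality of a maximal independent set of $H$ (equivalently, of an independent dominating set). A graph $G$ is domination perfect if $\gamma(H)=i(H)$ for every induced subgraph $H$ of $G$. Theorem. A graph $G$ is domination perfect if and only if $G$ contains none of the following $17$ graphs $G_1,\dots,G_{17}$ as an induced subgraph (up to isomorphism). Here $G_j$ has vertex set $\{0,1,\dots,n-1\}$, and $a\text{-}b$ denotes an edge joining $a$ and $b$. - $G_{1}$: $n=6$, edges $0\text{-}1,\ 1\text{-}2,\ 1\text{-}4,\ 3\text{-}4,\ 4\text{-}5$. - $G_{2}$: $n=6$, edges $0\text{-}1,\ 0\text{-}3,\ 1\text{-}2,\ 1\text{-}4,\ 3\text{-}4,\ 4\text{-}5$. - $G_{3}$: $n=6$, edges $0\text{-}1,\ 0\text{-}3,\ 0\text{-}5,\ 1\text{-}2,\ 1\text{-}4,\ 3\text{-}4,\ 4\text{-}5$. - $G_{4}$: $n=6$, edges $0\text{-}1,\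 0\text{-}3,\ 0\text{-}5,\ 1\text{-}2,\ 1\text{-}4,\ 2\text{-}3,\ 2\text{-}5,\ 3\text{-}4,\ 4\text{-}5$. - $G_{5}$: $n=7$, edges $0\text{-}1,\ 0\text{-}4,\ 1\text{-}2,\ 1\text{-}3,\ 1\text{-}5,\ 2\text{-}6,\ 3\text{-}5,\ 4\text{-}5,\ 5\text{-}6$. - $G_{6}$: $n=7$, edges $0\text{-}1,\ 0\text{-}3,\ 0\text{-}4,\ 0\text{-}6,\ 1\text{-}2,\ 1\text{-}3,\ 1\text{-}5,\ 2\text{-}6,\ 3\text{-}5,\ 3\text{-}6,\ 4\text{-}5,\ 5\text{-}6$. - $G_{7}$: $n=8$, edges $0\text{-}1,\ 0\text{-}5,\ 1\text{-}2,\ 1\text{-}3,\ 1\text{-}4,\ 1\text{-}6,\ 2\text{-}3,\ 2\text{-}7,\ 3\text{-}6,\ 4\text{-}6,\ 4\text{-}7,\ 5\text{-}6,\ 6\text{-}7$. - $G_{8}$: $n=8$, edges $0\text{-}1,\ 0\text{-}5,\ 1\text{-}2,\ 1\text{-}3,\ 1\text{-}4,\ 1\text{-}6,\ 2\text{-}7,\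 3\text{-}5,\ 3\text{-}6,\ 4\text{-}6,\ 4\text{-}7,\ 5\text{-}6,\ 6\text{-}7$. - $G_{9}$: $n=8$, edges $0\text{-}1,\ 0\text{-}5,\ 1\text{-}2,\ 1\text{-}3,\ 1\text{-}4,\ 1\text{-}6,\ 2\text{-}3,\ 2\text{-}7,\ 3\text{-}5,\ 3\text{-}6,\ 4\text{-}6,\ 4\text{-}7,\ 5\text{-}6,\ 6\text{-}7$. - $G_{10}$: $n=8$, edges $0\text{-}1,\ 0\text{-}5,\ 1\text{-}2,\ 1\text{-}3,\ 1\text{-}4,\ 1\text{-}6,\ 2\text{-}3,\ 2\text{-}7,\ 3\text{-}4,\ 3\text{-}6,\ 4\text{-}6,\ 4\text{-}7,\ 5\text{-}6,\ 6\text{-}7$. - $G_{11}$: $n=8$, edges $0\text{-}1,\ 0\text{-}5,\ 1\text{-}2,\ 1\text{-}3,\ 1\text{-}4,\ 1\text{-}6,\ 2\text{-}7,\ 3\text{-}4,\ 3\text{-}5,\ 3\text{-}6,\ 4\text{-}6,\ 4\text{-}7,\ 5\text{-}6,\ 6\text{-}7$. - $G_{12}$: $n=8$, edges $0\text{-}1,\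 0\text{-}5,\ 1\text{-}2,\ 1\text{-}3,\ 1\text{-}4,\ 1\text{-}6,\ 2\text{-}3,\ 2\text{-}7,\ 3\text{-}4,\ 3\text{-}5,\ 3\text{-}6,\ 4\text{-}6,\ 4\text{-}7,\ 5\text{-}6,\ 6\text{-}7$. - $G_{13}$: $n=8$, edges $0\text{-}1,\ 0\text{-}4,\ 0\text{-}5,\ 1\text{-}2,\ 1\text{-}3,\ 1\text{-}4,\ 1\text{-}6,\ 2\text{-}3,\ 2\text{-}7,\ 3\text{-}4,\ 3\text{-}5,\ 3\text{-}6,\ 4\text{-}6,\ 4\text{-}7,\ 5\text{-}6,\ 6\text{-}7$. - $G_{14}$: $n=9$, edges $0\text{-}2,\ 0\text{-}3,\ 0\text{-}6,\ 0\text{-}7,\ 1\text{-}2,\ 1\text{-}5,\ 1\text{-}6,\ 2\text{-}3,\ 2\text{-}4,\ 2\text{-}5,\ 2\text{-}7,\ 3\text{-}4,\ 3\text{-}8,\ 4\text{-}6,\ 4\text{-}7,\ 5\text{-}7,\ 5\text{-}8,\ 6\text{-}7,\ 7\text{-}8$. - $G_{15}$: $n=9$, edges $0\text{-}1,\ 0\text{-}2,\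 0\text{-}6,\ 0\text{-}7,\ 1\text{-}2,\ 1\text{-}5,\ 1\text{-}6,\ 2\text{-}3,\ 2\text{-}4,\ 2\text{-}5,\ 2\text{-}7,\ 3\text{-}4,\ 3\text{-}8,\ 4\text{-}6,\ 4\text{-}7,\ 5\text{-}7,\ 5\text{-}8,\ 6\text{-}7,\ 7\text{-}8$. - $G_{16}$: $n=9$, edges $0\text{-}1,\ 0\text{-}2,\ 0\text{-}3,\ 0\text{-}6,\ 0\text{-}7,\ 0\text{-}8,\ 1\text{-}2,\ 1\text{-}5,\ 1\text{-}6,\ 2\text{-}3,\ 2\text{-}4,\ 2\text{-}5,\ 2\text{-}7,\ 3\text{-}4,\ 3\text{-}8,\ 4\text{-}6,\ 4\text{-}7,\ 5\text{-}7,\ 5\text{-}8,\ 6\text{-}7,\ 7\text{-}8$. - $G_{17}$: $n=11$, edges $0\text{-}1,\ 0\text{-}2,\ 0\text{-}3,\ 0\text{-}4,\ 0\text{-}5,\ 0\text{-}8,\ 1\text{-}2,\ 1\text{-}5,\ 1\text{-}6,\ 1\text{-}9,\ 2\text{-}3,\ 2\text{-}4,\ 2\text{-}5,\ 2\text{-}7,\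 2\text{-}9,\ 2\text{-}10,\ 3\text{-}4,\ 3\text{-}8,\ 3\text{-}9,\ 3\text{-}10,\ 4\text{-}6,\ 4\text{-}7,\ 5\text{-}7,\ 5\text{-}8,\ 5\text{-}10,\ 6\text{-}7,\ 6\text{-}9,\ 7\text{-}8,\ 7\text{-}10,\ 8\text{-}10,\ 9\text{-}10$. -/

import Mathlib

namespace DomPerfect

variable {V : Type*}

/-- `D` is a dominating set of `G`: every vertex lies in `D` or has a neighbour in `D`. -/
def IsDominating (G : SimpleGraph V) (D : Finset V) : Prop :=
  ∀ x : V, x ∈ D ∨ ∃ y ∈ D, G.Adj y x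

/-- The domination number `γ(G)`: the minimum cardinality of a dominating set. For finite `V` the
set of cardinalities is nonempty, so the infimum is attained. -/
noncomputable def dominationNumber (G : SimpleGraph V) : ℕ :=
  sInf {n | ∃ D : Finset V, IsDominating G D ∧ D.card = n}

/-- The independent domination number `i(G)`: the minimum cardinality of a maximal independent set.
For finite `V` a maximal independent set exists, so the infimum is attained. -/
noncomputable def independentDominationNumber (G : SimpleGraph V) : ℕ :=
  sInf {n | ∃ D : Finset V, Maximal (fun S : Finset V => G.IsIndepSet (S : Set V)) D ∧ D.card = n}

/-- `G` is domination perfect: `γ(H) = i(H)` for every induced subgraph `H` of `G`. -/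
def IsDominationPerfect (G : SimpleGraph V) : Prop :=
  ∀ S : Set V, dominationNumber (G.induce S) = independentDominationNumber (G.induce S)

/-- The simple graph on `{0, …, n - 1}` with the listed edges. -/
def graphOfEdges (n : ℕ) (l : List (Fin n × Fin n)) : SimpleGraph (Fin n) :=
  SimpleGraph.fromRel (fun a b => (a, b) ∈ l)

/-! The seventeen graphs `G_1, …, G_17`, given by their edge lists. The numbering of the vertices is
row by row, from top to bottom and left to right, in the usual drawings. -/

/-- The graph `G_{1}`. -/
def G1 : SimpleGraph (Fin 6) :=
  graphOfEdges 6
    [(0, 1), (1, 2), (1, 4), (3, 4), (4, 5)]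

/-- The graph `G_{2}`. -/
def G2 : SimpleGraph (Fin 6) :=
  graphOfEdges 6
    [(0, 1), (0, 3), (1, 2), (1, 4), (3, 4), (4, 5)]

/-- The graph `G_{3}`. -/
def G3 : SimpleGraph (Fin 6) :=
  graphOfEdges 6
    [(0, 1), (0, 3), (0, 5), (1, 2), (1, 4), (3, 4), (4, 5)]

/-- The graph `G_{4}`. -/
def G4 : SimpleGraph (Fin 6) :=
  graphOfEdges 6
    [(0, 1), (0, 3), (0, 5), (1, 2), (1, 4), (2, 3), (2, 5), (3, 4), (4, 5)]

/-- The graph `G_{5}`. -/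
def G5 : SimpleGraph (Fin 7) :=
  graphOfEdges 7
    [(0, 1), (0, 4), (1, 2), (1, 3), (1, 5), (2, 6), (3, 5), (4, 5), (5, 6)]

/-- The graph `G_{6}`. -/
def G6 : SimpleGraph (Fin 7) :=
  graphOfEdges 7
    [(0, 1), (0, 3), (0, 4), (0, 6), (1, 2), (1, 3), (1, 5), (2, 6), (3, 5), (3, 6),
     (4, 5), (5, 6)]

/-- The graph `G_{7}`. -/
def G7 : SimpleGraph (Fin 8) :=
  graphOfEdges 8
    [(0, 1), (0, 5), (1, 2), (1, 3), (1, 4), (1, 6), (2, 3), (2, 7), (3, 6), (4, 6),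
     (4, 7), (5, 6), (6, 7)]

/-- The graph `G_{8}`. -/
def G8 : SimpleGraph (Fin 8) :=
  graphOfEdges 8
    [(0, 1), (0, 5), (1, 2), (1, 3), (1, 4), (1, 6), (2, 7), (3, 5), (3, 6), (4, 6),
     (4, 7), (5, 6), (6, 7)]

/-- The graph `G_{9}`. -/
def G9 : SimpleGraph (Fin 8) :=
  graphOfEdges 8
    [(0, 1), (0, 5), (1, 2), (1, 3), (1, 4), (1, 6), (2, 3), (2, 7), (3, 5), (3, 6),
     (4, 6), (4, 7), (5, 6), (6, 7)]

/-- The graph `G_{10}`. -/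
def G10 : SimpleGraph (Fin 8) :=
  graphOfEdges 8
    [(0, 1), (0, 5), (1, 2), (1, 3), (1, 4), (1, 6), (2, 3), (2, 7), (3, 4), (3, 6),
     (4, 6), (4, 7), (5, 6), (6, 7)]

/-- The graph `G_{11}`. -/
def G11 : SimpleGraph (Fin 8) :=
  graphOfEdges 8
    [(0, 1), (0, 5), (1, 2), (1, 3), (1, 4), (1, 6), (2, 7), (3, 4), (3, 5), (3, 6),
     (4, 6), (4, 7), (5, 6), (6, 7)]

/-- The graph `G_{12}`. -/
def G12 : SimpleGraph (Fin 8) :=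
  graphOfEdges 8
    [(0, 1), (0, 5), (1, 2), (1, 3), (1, 4), (1, 6), (2, 3), (2, 7), (3, 4), (3, 5),
     (3, 6), (4, 6), (4, 7), (5, 6), (6, 7)]

/-- The graph `G_{13}`. -/
def G13 : SimpleGraph (Fin 8) :=
  graphOfEdges 8
    [(0, 1), (0, 4), (0, 5), (1, 2), (1, 3), (1, 4), (1, 6), (2, 3), (2, 7), (3, 4),
     (3, 5), (3, 6), (4, 6), (4, 7), (5, 6), (6, 7)]

/-- The graph `G_{14}`. -/
def G14 : SimpleGraph (Fin 9) :=
  graphOfEdges 9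
    [(0, 2), (0, 3), (0, 6), (0, 7), (1, 2), (1, 5), (1, 6), (2, 3), (2, 4), (2, 5),
     (2, 7), (3, 4), (3, 8), (4, 6), (4, 7), (5, 7), (5, 8), (6, 7), (7, 8)]

/-- The graph `G_{15}`. -/
def G15 : SimpleGraph (Fin 9) :=
  graphOfEdges 9
    [(0, 1), (0, 2), (0, 6), (0, 7), (1, 2), (1, 5), (1, 6), (2, 3), (2, 4), (2, 5),
     (2, 7), (3, 4), (3, 8), (4, 6), (4, 7), (5, 7), (5, 8), (6, 7), (7, 8)]

/-- The graph `G_{16}`. -/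
def G16 : SimpleGraph (Fin 9) :=
  graphOfEdges 9
    [(0, 1), (0, 2), (0, 3), (0, 6), (0, 7), (0, 8), (1, 2), (1, 5), (1, 6), (2, 3),
     (2, 4), (2, 5), (2, 7), (3, 4), (3, 8), (4, 6), (4, 7), (5, 7), (5, 8), (6, 7),
     (7, 8)]

/-- The graph `G_{17}`. -/
def G17 : SimpleGraph (Fin 11) :=
  graphOfEdges 11
    [(0, 1), (0, 2), (0, 3), (0, 4), (0, 5), (0, 8), (1, 2), (1, 5), (1, 6), (1, 9),
     (2, 3), (2, 4), (2, 5), (2, 7), (2, 9), (2, 10), (3, 4), (3, 8), (3, 9), (3, 10),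
     (4, 6), (4, 7), (5, 7), (5, 8), (5, 10), (6, 7), (6, 9), (7, 8), (7, 10), (8, 10),
     (9, 10)]

/-- The family of the seventeen graphs, each with its number of vertices; `forbidden j` is the graph
numbered `j + 1` above. -/
def forbidden : Fin 17 → Σ n : ℕ, SimpleGraph (Fin n) :=
  ![⟨6, G1⟩, ⟨6, G2⟩, ⟨6, G3⟩, ⟨6, G4⟩, ⟨7, G5⟩, ⟨7, G6⟩,
    ⟨8, G7⟩, ⟨8, G8⟩, ⟨8, G9⟩, ⟨8, G10⟩, ⟨8, G11⟩, ⟨8, G12⟩,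
    ⟨8, G13⟩, ⟨9, G14⟩, ⟨9, G15⟩, ⟨9, G16⟩, ⟨11, G17⟩]

end DomPerfect

/-! Always `γ ≤ i`, so only the obstructions to equality matter. The basic one is a graph with a
dominating edge but no dominating set consisting of one vertex or of two nonadjacent vertices: there
`γ ≤ 2 < i`. Each of the seventeen graphs is of this kind, so a domination perfect graph contains
none of them.

For the converse, being free of the seventeen graphs passes to induced subgraphs, so it suffices to
prove `γ(G) = i(G)`. Among the minimum dominating sets choose a `D` spanning the fewest edges, and
suppose that it spans an edge `uv`. On the vertices for which `D` needs `u` or `v` (`residue`), `uv`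
is a dominating edge. If one vertex, or two nonadjacent ones, dominated the residue as well, they
could replace `u` and `v`, giving a dominating set that is no larger and spans fewer edges
(`exists_isDominating_fewer_edges`). Otherwise the residue is a basic obstruction, and it contains
one of the seventeen graphs by `not_isDominatingEdge`. Hence `D` is independent.

The combinatorial core is `not_isDominatingEdge`. It is a finite case analysis around the dominating
edge, alternating two moves: name a vertex missed by two equal or nonadjacent vertices, and ask
whether two distinct vertices are adjacent. A branch closes when a vertex is missed by the
dominating edge, or when a forbidden graph or an already refuted configuration appears. The analysis
is stored as a tree, whose checker is proved sound in `Refutation.not_holds_of_check`. -/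

namespace DomPerfect

/-! ### Basic obstructions and partially specified graphs -/

/-- Every pair of equal or nonadjacent vertices leaves some vertex undominated. -/
def NoIndepDominatingPair {V : Type*} (G : SimpleGraph V) : Prop :=
  ∀ x y, ¬ G.Adj x y → ∃ w, w ≠ x ∧ w ≠ y ∧ ¬ G.Adj x w ∧ ¬ G.Adj y w

/-- `u` and `v` are adjacent, and together they dominate `G`. -/
def IsDominatingEdge {V : Type*} (G : SimpleGraph V) (u v : V) : Prop :=
  G.Adj u v ∧ ∀ w, G.Adj u w ∨ G.Adj v w

theorem IsDominatingEdge.symm {V : Type*} {G : SimpleGraph V} {u v : V}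
    (h : IsDominatingEdge G u v) : IsDominatingEdge G v u :=
  ⟨h.1.symm, fun w => (h.2 w).symm⟩

/-- A partially specified graph on vertices named by natural numbers: the pairs in `pos` are
adjacent, the pairs in `neg` are distinct and nonadjacent. -/
structure Pattern where
  pos : List (ℕ × ℕ)
  neg : List (ℕ × ℕ)

namespace Pattern

/-- `f` realizes the pattern `P` in `G`. -/
def Realizes {V : Type*} (G : SimpleGraph V) (P : Pattern) (f : ℕ → V) : Prop :=
  (∀ p ∈ P.pos, G.Adj (f p.1) (f p.2)) ∧
    ∀ p ∈ P.neg, f p.1 ≠ f p.2 ∧ ¬ G.Adj (f p.1) (f p.2)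

/-- `P` has no realization in `G` that sends `0` and `1` to the ends of a dominating edge. -/
def Excluded {V : Type*} (G : SimpleGraph V) (P : Pattern) : Prop :=
  ∀ f : ℕ → V, IsDominatingEdge G (f 0) (f 1) → ¬ P.Realizes G f

/-- The pattern of a graph on `{0, …, n - 1}`, with its vertices renamed to `2, …, n + 1`. -/
def ofGraph {n : ℕ} (H : SimpleGraph (Fin n)) [DecidableRel H.Adj] : Pattern where
  pos := ((List.finRange n ×ˢ List.finRange n).filter fun p => H.Adj p.1 p.2).map
    fun p => (p.1.val + 2, p.2.val + 2)
  neg := ((List.finRange n ×ˢ List.finRange n).filter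
    fun p => p.1 ≠ p.2 ∧ ¬ H.Adj p.1 p.2).map fun p => (p.1.val + 2, p.2.val + 2)

/-- A realization is injective for free, since adjacent vertices differ and every pair in `neg` is
required to be distinct; it is therefore an induced copy of `H`. The names `0` and `1` do not occur
in the pattern, so the dominating edge plays no role. -/
theorem excluded_ofGraph {V : Type*} {G : SimpleGraph V} {n : ℕ} {H : SimpleGraph (Fin n)}
    [DecidableRel H.Adj] (h : ¬ H.IsIndContained G) : (ofGraph H).Excluded G := by
  rintro f - ⟨hpos, hneg⟩
  have hadj (a b : Fin n) (hab : H.Adj a b) : G.Adj (f (a + 2)) (f (b + 2)) :=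
    hpos (a + 2, b + 2) (by
      simp only [ofGraph, List.mem_map, List.mem_filter]
      exact ⟨(a, b), ⟨by simp, by simpa using hab⟩, rfl⟩)
  have hnon (a b : Fin n) (hne : a ≠ b) (hab : ¬ H.Adj a b) :
      f (a + 2) ≠ f (b + 2) ∧ ¬ G.Adj (f (a + 2)) (f (b + 2)) :=
    hneg (a + 2, b + 2) (by
      simp only [ofGraph, List.mem_map, List.mem_filter]
      exact ⟨(a, b), ⟨by simp, by simpa using ⟨hne, hab⟩⟩, rfl⟩)
  refine h ⟨⟨⟨fun a => f (a + 2), fun a b hab => ?_⟩, fun {a b} => ?_⟩⟩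
  · by_contra hne
    by_cases hH : H.Adj a b
    · exact (hadj a b hH).ne hab
    · exact (hnon a b hne hH).1 hab
  · refine ⟨fun hG => ?_, hadj a b⟩
    by_contra hH
    rcases eq_or_ne a b with rfl | hne
    · exact G.loopless.irrefl _ hG
    · exact (hnon a b hne hH).2 hG

end Pattern

/-! ### Partial knowledge of a graph as bit masks -/

/-- Adjacencies and nonadjacencies between vertices named by natural numbers, as bit masks: the pair
`(a, b)` is stored in the bit `Nat.pair a b`. -/
structure Facts where
  adj : ℕ
  non : ℕ

namespace Facts

/-- The mask `m` together with the pairs `(a, b)` and `(b, a)`. -/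
def insertPair (m a b : ℕ) : ℕ := m ||| 2 ^ Nat.pair a b ||| 2 ^ Nat.pair b a

theorem testBit_insertPair {m a b i j : ℕ} :
    (insertPair m a b).testBit (Nat.pair i j) = true ↔
      m.testBit (Nat.pair i j) = true ∨ (a = i ∧ b = j) ∨ (b = i ∧ a = j) := by
  simp [insertPair, Nat.testBit_or, Nat.testBit_two_pow, Nat.pair_eq_pair, or_assoc]

/-- Records that `a` and `b` are adjacent. -/
def addAdj (s : Facts) (a b : ℕ) : Facts := ⟨insertPair s.adj a b, s.non⟩

/-- Records that `a` and `b` are distinct and nonadjacent. -/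
def addNon (s : Facts) (a b : ℕ) : Facts := ⟨s.adj, insertPair s.non a b⟩

/-- `a` and `b` are known to be adjacent. -/
def hasAdj (s : Facts) (a b : ℕ) : Bool := s.adj.testBit (Nat.pair a b)

/-- `a` and `b` are known to be distinct and nonadjacent. -/
def hasNon (s : Facts) (a b : ℕ) : Bool := s.non.testBit (Nat.pair a b)

/-- `f` realizes the facts `s` in `G`. -/
def Holds {V : Type*} (G : SimpleGraph V) (s : Facts) (f : ℕ → V) : Prop :=
  (∀ i j, s.hasAdj i j → G.Adj (f i) (f j)) ∧
    ∀ i j, s.hasNon i j → f i ≠ f j ∧ ¬ G.Adj (f i) (f j)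

variable {V : Type*} {G : SimpleGraph V} {s : Facts} {f : ℕ → V}

theorem Holds.addAdj (h : s.Holds G f) {a b : ℕ} (hab : G.Adj (f a) (f b)) :
    (s.addAdj a b).Holds G f := by
  refine ⟨fun i j hij => ?_, h.2⟩
  rcases testBit_insertPair.1 hij with hij | ⟨rfl, rfl⟩ | ⟨rfl, rfl⟩
  exacts [h.1 i j hij, hab, hab.symm]

theorem Holds.addNon (h : s.Holds G f) {a b : ℕ} (hne : f a ≠ f b) (hab : ¬ G.Adj (f a) (f b)) :
    (s.addNon a b).Holds G f := by
  refine ⟨h.1, fun i j hij => ?_⟩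
  rcases testBit_insertPair.1 hij with hij | ⟨rfl, rfl⟩ | ⟨rfl, rfl⟩
  exacts [h.2 i j hij, ⟨hne, hab⟩, ⟨hne.symm, fun h => hab h.symm⟩]

/-- The facts `s` do not mention vertices from `w` on. -/
def isFresh (s : Facts) (w : ℕ) : Bool := s.adj < 2 ^ (w * w) && s.non < 2 ^ (w * w)

/-- `Nat.pair i j` is at least the square of `max i j`, so a code below `w * w` belongs to a pair of
names below `w`. One comparison of the mask with `2 ^ (w * w)` thus certifies that `w` is unused. -/
theorem lt_of_testBit_pair {m w i j : ℕ} (hm : m < 2 ^ (w * w))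
    (h : m.testBit (Nat.pair i j) = true) : i ≠ w ∧ j ≠ w := by
  have h1 : Nat.pair i j < w * w := by
    by_contra! hle
    have := Nat.testBit_lt_two_pow (hm.trans_le (Nat.pow_le_pow_right two_pos hle))
    simp [this] at h
  have h2 := Nat.max_sq_add_min_le_pair i j
  constructor <;> rintro rfl
  · exact ((Nat.mul_self_le_mul_self (le_max_left i j)).trans
      (by rw [← sq]; exact Nat.le_of_add_right_le h2)).not_gt h1
  · exact ((Nat.mul_self_le_mul_self (le_max_right i j)).trans
      (by rw [← sq]; exact Nat.le_of_add_right_le h2)).not_gt h1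

theorem Holds.update (h : s.Holds G f) {w : ℕ} (hw : s.isFresh w) (x : V) :
    s.Holds G (Function.update f w x) := by
  simp only [isFresh, Bool.and_eq_true, decide_eq_true_eq] at hw
  refine ⟨fun i j hij => ?_, fun i j hij => ?_⟩
  · obtain ⟨hi, hj⟩ := lt_of_testBit_pair hw.1 hij
    simpa [hi, hj] using h.1 i j hij
  · obtain ⟨hi, hj⟩ := lt_of_testBit_pair hw.2 hij
    simpa [hi, hj] using h.2 i j hij

/-- The facts expressed by a pattern, together with the adjacency of `0` and `1`. -/
def ofPattern (P : Pattern) : Facts :=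
  P.neg.foldl (fun s p => s.addNon p.1 p.2)
    (P.pos.foldl (fun s p => s.addAdj p.1 p.2) (addAdj ⟨0, 0⟩ 0 1))

theorem holds_ofPattern {P : Pattern} (h01 : G.Adj (f 0) (f 1)) (hP : P.Realizes G f) :
    (ofPattern P).Holds G f := by
  have hpos (l : List (ℕ × ℕ)) (hl : ∀ p ∈ l, G.Adj (f p.1) (f p.2)) (s : Facts)
      (hs : s.Holds G f) : (l.foldl (fun s p => s.addAdj p.1 p.2) s).Holds G f := by
    induction l generalizing s with
    | nil => exact hs
    | cons p l ih =>
      exact ih (fun q hq => hl q (List.mem_cons_of_mem _ hq)) _ (hs.addAdj (hl p List.mem_cons_self))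
  have hneg (l : List (ℕ × ℕ)) (hl : ∀ p ∈ l, f p.1 ≠ f p.2 ∧ ¬ G.Adj (f p.1) (f p.2))
      (s : Facts) (hs : s.Holds G f) : (l.foldl (fun s p => s.addNon p.1 p.2) s).Holds G f := by
    induction l generalizing s with
    | nil => exact hs
    | cons p l ih =>
      have hp := hl p List.mem_cons_self
      exact ih (fun q hq => hl q (List.mem_cons_of_mem _ hq)) _ (hs.addNon hp.1 hp.2)
  exact hneg _ hP.2 _ (hpos _ hP.1 _ (Holds.addAdj (by simp [Holds, hasAdj, hasNon]) h01))

end Facts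

/-! ### Refutation trees and their soundness -/

/-- A refutation of a set of facts about a graph with dominating edge `(0, 1)`.
* `occ k l`: the `k`-th excluded pattern occurs, its vertices `0, 1` being sent to `0, 1` and its
  vertices `2, 3, …` to the entries of `l`.
* `occSwap k l`: the same, with `0, 1` sent to `1, 0`.
* `undom w`: the vertex `w` is adjacent neither to `0` nor to `1`.
* `split a b r s`: `a` and `b` are known to be distinct, `r` treats the case that they are adjacent
  and `s` the case that they are not.
* `wit a b w r`: `a` and `b` are equal or nonadjacent, and `w` is a new name for a vertex that
  they do not dominate. -/
inductive Refutation where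
  | occ (k : ℕ) (l : List ℕ)
  | occSwap (k : ℕ) (l : List ℕ)
  | undom (w : ℕ)
  | split (a b : ℕ) (r s : Refutation)
  | wit (a b w : ℕ) (r : Refutation)

namespace Refutation

/-- The renaming of vertices in `Refutation.occ` and `Refutation.occSwap`. -/
def rename (swap : Bool) (l : List ℕ) : ℕ → ℕ
  | 0 => if swap then 1 else 0
  | 1 => if swap then 0 else 1
  | i + 2 => l.getD i 0

/-- Checks that the renaming `e` carries the `k`-th pattern in `env` to known facts. -/
def occurs (env : List Pattern) (k : ℕ) (e : ℕ → ℕ) (s : Facts) : Bool :=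
  match env[k]? with
  | none => false
  | some P =>
    (P.pos.all fun p => s.hasAdj (e p.1) (e p.2)) && P.neg.all fun p => s.hasNon (e p.1) (e p.2)

/-- Composing `f` with the renaming `e` realizes the excluded pattern. Nothing is asked of `e`
itself, because every required pair is looked up among the known facts; the default `0` in `rename`
is therefore harmless. -/
theorem not_holds_of_occurs {V : Type*} {G : SimpleGraph V} {env : List Pattern}
    (henv : ∀ P ∈ env, P.Excluded G) {k : ℕ} {e : ℕ → ℕ} {s : Facts}
    (h : occurs env k e s = true) {f : ℕ → V} (hf : IsDominatingEdge G (f (e 0)) (f (e 1))) :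
    ¬ s.Holds G f := by
  intro hs
  rw [occurs] at h
  split at h
  · simp at h
  · rename_i P hP
    simp only [Bool.and_eq_true, List.all_eq_true] at h
    exact henv P (List.mem_of_getElem? hP) (f ∘ e) hf
      ⟨fun p hp => hs.1 _ _ (h.1 p hp), fun p hp => hs.2 _ _ (h.2 p hp)⟩

/-- Checks a refutation of the facts `s`, given that the patterns in `env` are excluded. -/
def check (env : List Pattern) : Refutation → Facts → Bool
  | occ k l, s => occurs env k (rename false l) s
  | occSwap k l, s => occurs env k (rename true l) s
  | undom w, s => s.hasNon 0 w && s.hasNon 1 w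
  | split a b r t, s =>
    ((List.range a).any fun c => s.hasAdj c b && s.hasNon c a) &&
      check env r (s.addAdj a b) && check env t (s.addNon a b)
  | wit a b w r, s =>
    (a == b || s.hasNon a b) && decide (2 ≤ w ∧ a < w ∧ b < w) && s.isFresh w &&
      check env r ((s.addNon a w).addNon b w)

theorem not_holds_of_check {V : Type*} {G : SimpleGraph V} (hG : NoIndepDominatingPair G)
    {env : List Pattern} (henv : ∀ P ∈ env, P.Excluded G) (r : Refutation) (s : Facts)
    (hr : r.check env s = true) (f : ℕ → V) (hf : IsDominatingEdge G (f 0) (f 1)) :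
    ¬ s.Holds G f := by
  intro hs
  induction r generalizing s f with
  | occ k l => exact not_holds_of_occurs henv hr hf hs
  | occSwap k l => exact not_holds_of_occurs henv hr hf.symm hs
  | undom w =>
    simp only [check, Bool.and_eq_true] at hr
    exact (hf.2 (f w)).elim (hs.2 _ _ hr.1).2 (hs.2 _ _ hr.2).2
  | split a b r t ihr iht =>
    simp only [check, Bool.and_eq_true, List.any_eq_true] at hr
    obtain ⟨⟨⟨c, -, hcb, hca⟩, hr⟩, ht⟩ := hr
    by_cases hab : G.Adj (f a) (f b)
    · exact ihr _ hr f hf (hs.addAdj hab)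
    -- The check supplies a vertex `c` adjacent to `b` but not to `a`, so `f a = f b` is impossible.
    · refine iht _ ht f hf (hs.addNon (fun he => (hs.2 _ _ hca).2 ?_) hab)
      rw [he]
      exact hs.1 _ _ hcb
  | wit a b w r ih =>
    simp only [check, Bool.and_eq_true, Bool.or_eq_true, beq_iff_eq, decide_eq_true_eq] at hr
    obtain ⟨⟨⟨hab, hw, haw, hbw⟩, hfresh⟩, hr⟩ := hr
    obtain ⟨x, hxa, hxb, hax, hbx⟩ := hG (f a) (f b) (by
      rcases hab with rfl | hab
      exacts [G.loopless.irrefl _, (hs.2 _ _ hab).2])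
    have hna : Function.update f w x a = f a := Function.update_of_ne haw.ne _ _
    have hnb : Function.update f w x b = f b := Function.update_of_ne hbw.ne _ _
    have hnw : Function.update f w x w = x := Function.update_self _ _ _
    refine ih _ hr (Function.update f w x) ?_ (((hs.update hfresh x).addNon ?_ ?_).addNon ?_ ?_)
    -- The condition `2 ≤ w` keeps the ends `0` and `1` of the dominating edge in place.
    · rwa [Function.update_of_ne (by omega), Function.update_of_ne (by omega)]
    · rw [hna, hnw]; exact hxa.symm
    · rwa [hna, hnw]
    · rw [hnb, hnw]; exact hxb.symm
    · rwa [hnb, hnw]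

/-- Checks a list of patterns with refutations, each of which may use the preceding patterns. -/
def checkAll : List Pattern → List (Pattern × Refutation) → Bool
  | _, [] => true
  | env, p :: l => p.2.check env (Facts.ofPattern p.1) && checkAll (env ++ [p.1]) l

theorem excluded_of_checkAll {V : Type*} {G : SimpleGraph V} (hG : NoIndepDominatingPair G)
    {env : List Pattern} (henv : ∀ P ∈ env, P.Excluded G) (l : List (Pattern × Refutation))
    (hl : checkAll env l = true) : ∀ p ∈ l, p.1.Excluded G := by
  induction l generalizing env with
  | nil => simp
  | cons p l ih =>
    simp only [checkAll, Bool.and_eq_true] at hl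
    have hp : p.1.Excluded G := fun f hf hP =>
      not_holds_of_check hG henv p.2 _ hl.1 f hf (Facts.holds_ofPattern hf.1 hP)
    intro q hq
    rcases List.mem_cons.1 hq with rfl | hq
    · exact hp
    · refine ih (fun P hP => ?_) hl.2 q hq
      rcases List.mem_append.1 hP with hP | hP
      · exact henv P hP
      · rwa [List.mem_singleton.1 hP]

end Refutation

/-! ### The case analysis around a dominating edge -/

/-! The patterns refuted below are numbered from `17` on, after the seventeen graphs. Each of them is
refuted with the help of the preceding ones; the last one is empty. -/

/-- Call a neighbour of one end of the edge `01` private if the other end misses it. Here `2, 3` are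
private to `0`, `4` is private to `1`, and the three are independent. A vertex `5` missed by `0` and
`4` is adjacent to `1`; it yields `G1`, `G2` or `G3` according to whether it is adjacent to none,
one or both of `2, 3`. -/
def refutedPattern1 : Pattern × Refutation :=
  (⟨[(0, 2), (0, 3), (1, 4)],
     [(1, 2), (1, 3), (2, 3), (0, 4), (2, 4), (3, 4)]⟩,
   .wit 0 4 5 (.split 5 1 (.split 5 2 (.split 5 3 (.occ 2 [5, 1, 4, 2, 0, 3]) (.occ 1 [2, 0, 3, 5,
   1, 4])) (.split 5 3 (.occ 1 [3, 0, 2, 5, 1, 4]) (.occ 0 [4, 1, 5, 2, 0, 3]))) (.undom 5)))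

/-- An extension of the configuration of `refutedPattern9` by two vertices, split off because it
recurs in the refutation of the latter. -/
def refutedPattern2 : Pattern × Refutation :=
  (⟨[(0, 2), (0, 3), (1, 4), (3, 4), (1, 5), (2, 5), (0, 6), (1, 6), (2, 6), (4, 6), (0, 7), (1,
     7), (3, 7), (5, 7), (1, 8), (3, 8), (4, 8), (5, 8), (1, 9), (2, 9), (5, 9), (6, 9), (7, 9), (0,
     10), (1, 10), (2, 10), (4, 10), (6, 10), (8, 10)],
     [(1, 2), (1, 3), (2, 3), (0, 4), (2, 4), (0, 5), (3, 5), (4, 5), (3, 6), (5, 6), (2, 7), (4,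
     7), (6, 7), (0, 8), (2, 8), (6, 8), (7, 8), (0, 9), (3, 9), (4, 9), (8, 9), (3, 10), (5, 10),
     (7, 10), (9, 10)]⟩,
   .wit 7 10 11 (.split 11 8 (.split 11 2 (.split 11 5 (.split 11 3 (.split 11 1 (.occ 12 [10, 8, 3,
   11, 1, 2, 5, 7]) (.split 11 0 (.split 11 9 (.split 11 6 (.split 11 4 (.wit 1 11 12 (.split 12 0
   (.split 12 9 (.split 12 4 (.occ 3 [0, 1, 9, 12, 4, 11]) (.split 12 2 (.split 12 5 (.split 12 8
   (.occ 3 [1, 8, 11, 9, 12, 0]) (.split 12 6 (.split 12 3 (.occ 5 [11, 5, 1, 2, 3, 12, 6]) (.occ 2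
   [5, 11, 3, 1, 6, 12])) (.occ 5 [9, 1, 8, 6, 12, 0, 11]))) (.occ 2 [1, 0, 12, 5, 11, 4])) (.occ 2
   [9, 1, 4, 2, 0, 12]))) (.split 12 4 (.split 12 8 (.split 12 5 (.occ 3 [5, 11, 0, 12, 4, 1])
   (.split 12 10 (.split 12 6 (.split 12 7 (.occ 5 [1, 8, 11, 10, 7, 12, 6]) (.occ 2 [6, 1, 7, 11,
   8, 12])) (.occ 5 [0, 1, 5, 6, 12, 4, 11])) (.occ 2 [0, 11, 5, 10, 4, 12]))) (.occSwap 17 [8, 9,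
   12])) (.occSwap 17 [4, 9, 12]))) (.undom 12))) (.wit 1 11 12 (.split 12 0 (.split 12 4 (.split 12
   7 (.split 12 5 (.occ 5 [0, 12, 4, 7, 11, 5, 1]) (.split 12 9 (.occ 5 [1, 0, 11, 7, 4, 12, 9])
   (.split 12 8 (.split 12 6 (.occ 5 [8, 1, 7, 4, 11, 6, 12]) (.split 12 2 (.occ 2 [12, 2, 6, 8, 5,
   7]) (.wit 9 12 13 (.split 13 0 (.split 13 1 (.split 13 2 (.split 13 7 (.split 13 4 (.occ 12 [4,
   13, 2, 0, 1, 12, 7, 9]) (.occ 11 [4, 1, 9, 7, 13, 12, 0, 2])) (.split 13 8 (.split 13 11 (.occ 5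
   [0, 1, 9, 13, 12, 8, 11]) (.occ 2 [8, 11, 9, 13, 0, 12])) (.occ 8 [8, 1, 9, 7, 13, 12, 0, 2])))
   (.split 13 8 (.split 13 11 (.occ 5 [0, 1, 9, 13, 12, 8, 11]) (.occ 2 [8, 11, 9, 13, 0, 12]))
   (.occ 4 [2, 0, 12, 13, 9, 1, 8]))) (.occ 17 [13, 12, 9])) (.split 13 1 (.occSwap 17 [9, 13, 12])
   (.undom 13)))))) (.occSwap 17 [8, 9, 12])))) (.split 12 3 (.split 12 5 (.occ 2 [0, 12, 4, 7, 5,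
   11]) (.split 12 6 (.split 12 8 (.occ 2 [8, 1, 7, 11, 6, 12]) (.occ 1 [11, 6, 12, 8, 1, 7])) (.occ
   1 [7, 3, 12, 5, 11, 6]))) (.occ 1 [1, 4, 12, 7, 3, 11]))) (.occ 17 [11, 12, 4])) (.undom 12))))
   (.occ 2 [9, 11, 8, 7, 0, 6])) (.split 11 4 (.split 11 6 (.occ 1 [9, 6, 10, 5, 11, 3]) (.occ 11
   [7, 0, 11, 2, 10, 9, 6, 4])) (.occSwap 17 [4, 9, 11]))) (.undom 11))) (.split 11 1 (.occ 11 [3,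
   8, 10, 1, 11, 7, 5, 2]) (.occ 8 [3, 8, 10, 1, 11, 7, 5, 2]))) (.occ 2 [8, 5, 7, 10, 2, 11]))
   (.split 11 5 (.split 11 3 (.split 11 1 (.occ 11 [2, 5, 7, 1, 11, 10, 8, 3]) (.occ 8 [2, 5, 7, 1,
   11, 10, 8, 3])) (.occ 4 [2, 5, 7, 11, 10, 8, 3])) (.occ 1 [2, 5, 7, 10, 8, 11]))) (.split 11 5
   (.split 11 3 (.occ 2 [3, 8, 10, 7, 5, 11]) (.occ 1 [7, 5, 11, 3, 8, 10])) (.split 11 2 (.occ 1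
   [10, 2, 11, 8, 5, 7]) (.split 11 3 (.occ 1 [5, 8, 10, 7, 3, 11]) (.split 11 0 (.split 11 1
   (.split 11 4 (.occ 8 [2, 0, 3, 7, 11, 5, 1, 4]) (.occ 4 [5, 1, 4, 11, 2, 0, 3])) (.occ 17 [2, 11,
   8])) (.split 11 1 (.occSwap 17 [8, 11, 2]) (.undom 11))))))))

/-- The private neighbours induce the path `4-2-5-3`. By `refutedPattern1`, a vertex missed by `3`
and `4` is adjacent to both ends; its adjacencies to `2` and `5` then produce `G2`, `G3` or `G6`. -/
def refutedPattern3 : Pattern × Refutation :=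
  (⟨[(1, 2), (1, 3), (0, 4), (2, 4), (0, 5), (2, 5), (3, 5)],
     [(0, 2), (0, 3), (2, 3), (1, 4), (3, 4), (1, 5), (4, 5)]⟩,
   .wit 3 4 6 (.split 6 0 (.split 6 1 (.split 6 2 (.split 6 5 (.occ 5 [0, 5, 3, 6, 4, 2, 1]) (.occ 2
   [0, 5, 3, 4, 2, 6])) (.split 6 5 (.occ 2 [5, 2, 4, 6, 1, 3]) (.occ 1 [2, 5, 3, 4, 0, 6]))) (.occ
   17 [4, 6, 3])) (.split 6 1 (.occSwap 17 [6, 3, 4]) (.undom 6))))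

def refutedPattern4 : Pattern × Refutation :=
  (⟨[(1, 2), (1, 3), (1, 4), (0, 5), (2, 5), (4, 5)],
     [(0, 2), (0, 3), (2, 3), (0, 4), (2, 4), (1, 5), (3, 5)]⟩,
   .wit 1 5 6 (.split 6 0 (.split 6 3 (.split 6 2 (.occSwap 19 [6, 5, 3, 2]) (.split 6 4 (.occSwap
   19 [5, 6, 2, 4]) (.occSwap 17 [2, 4, 6]))) (.occ 17 [5, 6, 3])) (.undom 6)))

/-- Complements `refutedPattern1`: given two nonadjacent private neighbours of one end, every
private neighbour of the other end is adjacent to exactly one of them. A vertex missed by `0` and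
`4` is private to `1`; if adjacent to both `2` and `3` it gives `G4`, which is `K_{3,3}`, if to one
it gives `refutedPattern3`, and if to none `G3`. -/
def refutedPattern5 : Pattern × Refutation :=
  (⟨[(0, 2), (0, 3), (1, 4), (2, 4), (3, 4)],
     [(1, 2), (1, 3), (2, 3), (0, 4)]⟩,
   .wit 0 4 5 (.split 5 1 (.split 5 3 (.split 5 2 (.occ 3 [1, 4, 2, 5, 3, 0]) (.occ 19 [4, 5, 2,
   3])) (.split 5 2 (.occSwap 19 [2, 3, 5, 4]) (.occ 2 [4, 1, 5, 2, 0, 3]))) (.undom 5)))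

def refutedPattern6 : Pattern × Refutation :=
  (⟨[(0, 2), (0, 3), (1, 4), (3, 4), (0, 6), (4, 6), (0, 7), (1, 7), (3, 7), (5, 7), (0, 8), (1,
     8), (2, 8), (4, 8), (5, 8), (6, 8), (1, 9), (2, 9), (4, 9), (5, 9)],
     [(1, 2), (1, 3), (2, 3), (0, 4), (2, 4), (0, 5), (3, 5), (4, 5), (3, 6), (5, 6), (2, 7), (3,
     8), (7, 8), (0, 9), (3, 9), (6, 9), (7, 9), (8, 9)]⟩,
   .wit 0 9 10 (.split 10 1 (.split 10 2 (.occSwap 21 [9, 10, 2]) (.split 10 3 (.split 10 4 (.split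
   10 8 (.split 10 7 (.split 10 5 (.split 10 6 (.occ 11 [9, 4, 3, 10, 6, 5, 8, 0]) (.occ 8 [9, 4, 3,
   10, 6, 5, 8, 0])) (.occ 2 [8, 5, 9, 10, 7, 0])) (.occ 8 [9, 1, 10, 8, 7, 2, 0, 3])) (.split 10 5
   (.occ 2 [5, 8, 0, 10, 4, 9]) (.occ 1 [5, 8, 0, 9, 4, 10]))) (.occ 2 [1, 0, 2, 10, 3, 4]))
   (.occSwap 17 [9, 10, 3]))) (.undom 10)))

/-- The 4-cycles `0-3-5-1` and `0-2-6-1` share the edge `01`, and `4` is a common neighbour of the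
ends adjacent to exactly one of the four private vertices. A vertex missed by `3` and `6` must be
another common neighbour, and its adjacencies lead to `G5` or one of `G7` to `G12`. -/
def refutedPattern7 : Pattern × Refutation :=
  (⟨[(0, 2), (0, 3), (0, 4), (1, 4), (3, 4), (1, 5), (3, 5), (1, 6), (2, 6)],
     [(1, 2), (1, 3), (2, 3), (2, 4), (0, 5), (2, 5), (4, 5), (0, 6), (3, 6), (4, 6), (5, 6)]⟩,
   .wit 3 6 7 (.split 7 1 (.split 7 0 (.split 7 5 (.split 7 4 (.split 7 2 (.occ 11 [6, 1, 5, 7, 4,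
   2, 0, 3]) (.occ 9 [2, 0, 3, 4, 7, 6, 1, 5])) (.split 7 2 (.occ 8 [6, 1, 5, 7, 4, 2, 0, 3]) (.occ
   6 [2, 0, 3, 4, 7, 6, 1, 5]))) (.split 7 2 (.split 7 4 (.occ 10 [5, 1, 6, 4, 7, 3, 0, 2]) (.occ 7
   [5, 1, 6, 4, 7, 3, 0, 2])) (.occ 4 [3, 0, 2, 7, 5, 1, 6]))) (.occSwap 17 [7, 6, 3])) (.split 7 0
   (.occ 17 [7, 3, 6]) (.undom 7))))

def refutedPattern8 : Pattern × Refutation :=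
  (⟨[(0, 2), (0, 3), (1, 4), (3, 4), (1, 5), (2, 5), (0, 6), (1, 6), (3, 6), (5, 6), (1, 7), (3,
     7), (5, 7), (1, 8), (2, 8), (4, 8), (6, 8), (1, 9), (2, 9), (4, 9), (7, 9)],
     [(1, 2), (1, 3), (2, 3), (0, 4), (2, 4), (0, 5), (3, 5), (4, 5), (2, 6), (4, 6), (0, 7), (2,
     7), (6, 7), (0, 8), (7, 8), (3, 9), (5, 9), (6, 9), (8, 9)]⟩,
   .wit 6 9 10 (.split 10 2 (.split 10 7 (.split 10 5 (.split 10 3 (.split 10 1 (.occ 12 [3, 10, 2,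
   5, 7, 6, 1, 9]) (.split 10 0 (.split 10 8 (.occSwap 21 [8, 7, 10]) (.split 10 4 (.occ 2 [4, 8, 6,
   10, 2, 9]) (.occ 1 [9, 2, 10, 4, 8, 6]))) (.undom 10))) (.split 10 1 (.occ 11 [3, 7, 9, 1, 10, 6,
   5, 2]) (.occ 8 [3, 7, 9, 1, 10, 6, 5, 2]))) (.occ 2 [2, 5, 6, 10, 7, 9])) (.split 10 5 (.split 10
   3 (.occ 2 [3, 7, 9, 6, 5, 10]) (.occ 1 [6, 5, 10, 3, 7, 9])) (.occ 1 [9, 2, 10, 7, 5, 6])))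
   (.split 10 3 (.split 10 7 (.split 10 5 (.split 10 1 (.occ 11 [2, 5, 6, 1, 10, 9, 7, 3]) (.occ 8
   [2, 5, 6, 1, 10, 9, 7, 3])) (.occ 1 [9, 7, 10, 2, 5, 6])) (.split 10 5 (.occ 2 [3, 7, 9, 6, 5,
   10]) (.occ 1 [5, 7, 9, 6, 3, 10]))) (.split 10 7 (.split 10 5 (.occ 4 [3, 7, 9, 10, 6, 5, 2])
   (.occ 1 [3, 7, 10, 6, 5, 2])) (.split 10 5 (.occ 1 [2, 5, 10, 9, 7, 3]) (.split 10 1 (.split 10 0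
   (.split 10 4 (.occ 8 [2, 0, 3, 6, 10, 5, 1, 4]) (.occ 4 [5, 1, 4, 10, 2, 0, 3])) (.occSwap 17 [7,
   10, 2])) (.split 10 0 (.occ 17 [2, 10, 7]) (.undom 10))))))))

/-- Two 4-cycles on the edge `01`, with nonadjacent common neighbours `6, 7` of the ends attached to
the diagonal pairs `2, 4` and `3, 5`, and a further vertex `8` private to `1` and missed by `6, 7`.
This is by far the longest case, and the only one where `G17` arises. -/
def refutedPattern9 : Pattern × Refutation :=
  (⟨[(0, 2), (0, 3), (1, 4), (3, 4), (1, 5), (2, 5), (0, 6), (1, 6), (2, 6), (4, 6), (0, 7), (1,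
     7), (3, 7), (5, 7), (1, 8), (3, 8), (4, 8), (5, 8)],
     [(1, 2), (1, 3), (2, 3), (0, 4), (2, 4), (0, 5), (3, 5), (4, 5), (3, 6), (5, 6), (2, 7), (4,
     7), (6, 7), (0, 8), (2, 8), (6, 8), (7, 8)]⟩,
   .wit 0 8 9 (.split 9 1 (.split 9 2 (.split 9 3 (.split 9 7 (.occ 5 [3, 0, 2, 7, 8, 1, 9]) (.occ 2
   [3, 9, 2, 7, 1, 8])) (.split 9 5 (.split 9 6 (.split 9 4 (.split 9 7 (.wit 3 9 10 (.split 10 1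
   (.split 10 0 (.split 10 2 (.split 10 8 (.split 10 7 (.occ 12 [3, 7, 9, 1, 0, 8, 10, 2]) (.split
   10 6 (.split 10 4 (.split 10 5 (.wit 7 10 11 (.split 11 4 (.split 11 2 (.split 11 9 (.split 11 3
   (.split 11 1 (.occ 12 [7, 1, 10, 4, 9, 3, 11, 2]) (.split 11 0 (.split 11 8 (.occSwap 21 [9, 8,
   11]) (.split 11 5 (.occ 5 [10, 5, 7, 2, 4, 11, 0]) (.split 11 6 (.wit 1 11 12 (.split 12 0
   (.split 12 4 (.occ 21 [11, 12, 4]) (.split 12 5 (.split 12 8 (.split 12 9 (.occSwap 21 [9, 8,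
   12]) (.split 12 3 (.split 12 2 (.split 12 7 (.split 12 6 (.occ 2 [1, 6, 11, 7, 12, 8]) (.split 12
   10 (.wit 9 12 13 (.split 13 0 (.split 13 1 (.split 13 8 (.split 13 11 (.split 13 7 (.occ 12 [12,
   7, 9, 1, 0, 8, 13, 11]) (.split 13 6 (.split 13 10 (.split 13 2 (.split 13 4 (.split 13 3 (.wit 7
   13 14 (.split 14 2 (.split 14 8 (.split 14 12 (.split 14 9 (.split 14 0 (.occ 12 [13, 2, 9, 14,
   0, 8, 12, 7]) (.split 14 1 (.split 14 11 (.occ 21 [11, 12, 14]) (.split 14 4 (.split 14 3 (.occ 5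
   [3, 14, 2, 4, 7, 1, 13]) (.split 14 6 (.wit 0 14 15 (.split 15 1 (.split 15 2 (.occSwap 21 [14,
   15, 2]) (.split 15 8 (.split 15 3 (.split 15 11 (.split 15 9 (.split 15 12 (.occ 21 [11, 12, 15])
   (.split 15 7 (.split 15 13 (.split 15 6 (.occ 11 [8, 15, 7, 9, 11, 14, 6, 0]) (.occ 16 [9, 14, 1,
   15, 7, 6, 12, 0, 11, 8, 13])) (.occ 1 [11, 15, 7, 13, 8, 14])) (.occ 23 [2, 3, 7, 15, 14])))
   (.occSwap 21 [9, 15, 11])) (.occSwap 17 [14, 15, 11])) (.occSwap 17 [15, 14, 3])) (.occSwap 17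
   [8, 15, 2]))) (.undom 15))) (.occ 11 [7, 1, 14, 4, 6, 3, 13, 2]))) (.occ 23 [11, 12, 7, 14, 4])))
   (.undom 14))) (.split 14 4 (.occ 2 [4, 9, 7, 14, 2, 13]) (.occ 1 [13, 2, 14, 4, 9, 7]))) (.occ 2
   [8, 12, 7, 14, 2, 13])) (.split 14 12 (.split 14 9 (.split 14 0 (.occ 11 [8, 12, 7, 0, 14, 13, 2,
   9]) (.occ 8 [8, 12, 7, 0, 14, 13, 2, 9])) (.occ 4 [9, 2, 13, 14, 7, 12, 8])) (.occ 1 [13, 2, 14,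
   8, 12, 7]))) (.split 14 1 (.split 14 3 (.occ 2 [3, 13, 2, 7, 1, 14]) (.occ 1 [7, 1, 14, 3, 13,
   2])) (.split 14 0 (.split 14 8 (.split 14 9 (.occ 21 [2, 14, 9]) (.occSwap 23 [8, 9, 7, 2, 14]))
   (.occ 17 [2, 14, 8])) (.undom 14))))) (.occSwap 24 [8, 9, 11, 12, 7, 2, 3, 13])) (.occ 1 [2, 12,
   7, 13, 8, 4])) (.split 13 3 (.occ 16 [3, 11, 0, 12, 7, 13, 9, 1, 8, 2, 10]) (.occ 1 [8, 3, 7, 13,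
   11, 2]))) (.occ 14 [10, 8, 1, 9, 7, 13, 12, 0, 11])) (.occ 14 [6, 9, 1, 8, 13, 7, 11, 0, 12])))
   (.occSwap 23 [9, 8, 13, 12, 11])) (.split 13 11 (.occ 23 [12, 11, 13, 9, 8]) (.occ 4 [12, 0, 11,
   13, 8, 1, 9]))) (.occ 17 [12, 13, 9])) (.split 13 1 (.occSwap 17 [9, 13, 12]) (.undom 13))))
   (.occ 1 [8, 12, 7, 10, 2, 11]))) (.occSwap 23 [4, 5, 7, 12, 11])) (.occ 2 [5, 1, 4, 12, 0, 2]))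
   (.occ 17 [3, 12, 9]))) (.occ 17 [11, 12, 8])) (.occ 17 [12, 11, 5]))) (.undom 12))) (.occ 0 [11,
   2, 6, 8, 5, 7])))) (.undom 11))) (.split 11 1 (.occ 11 [3, 4, 10, 1, 11, 7, 9, 2]) (.occ 8 [3, 4,
   10, 1, 11, 7, 9, 2]))) (.occ 2 [2, 9, 7, 11, 4, 10])) (.split 11 9 (.split 11 3 (.split 11 1
   (.occ 11 [2, 9, 7, 1, 11, 10, 4, 3]) (.occ 8 [2, 9, 7, 1, 11, 10, 4, 3])) (.occ 4 [10, 4, 3, 11,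
   2, 9, 7])) (.occ 1 [10, 4, 11, 2, 9, 7]))) (.split 11 0 (.split 11 5 (.occ 2 [5, 10, 4, 7, 0,
   11]) (.occ 1 [7, 0, 11, 5, 10, 4])) (.split 11 1 (.split 11 5 (.occ 1 [0, 10, 4, 7, 5, 11])
   (.split 11 2 (.split 11 3 (.occ 2 [3, 11, 2, 4, 1, 7]) (.occ 2 [1, 0, 3, 5, 2, 11])) (.split 11 8
   (.occ 0 [4, 8, 11, 7, 5, 2]) (.occSwap 17 [8, 11, 2])))) (.undom 11))))) (.wit 7 10 11 (.split 11
   2 (.split 11 8 (.split 11 5 (.split 11 3 (.split 11 1 (.occ 12 [3, 11, 2, 5, 8, 7, 1, 10])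
   (.split 11 0 (.split 11 9 (.occSwap 21 [9, 8, 11]) (.split 11 4 (.occ 2 [4, 9, 7, 11, 2, 10])
   (.occ 1 [10, 2, 11, 4, 9, 7]))) (.undom 11))) (.split 11 1 (.occ 11 [3, 8, 10, 1, 11, 7, 5, 2])
   (.occ 8 [3, 8, 10, 1, 11, 7, 5, 2]))) (.occ 2 [2, 5, 7, 11, 8, 10])) (.split 11 5 (.split 11 3
   (.occ 2 [3, 8, 10, 7, 5, 11]) (.occ 1 [7, 5, 11, 3, 8, 10])) (.occ 1 [10, 2, 11, 8, 5, 7])))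
   (.split 11 3 (.split 11 8 (.split 11 5 (.split 11 1 (.occ 11 [2, 5, 7, 1, 11, 10, 8, 3]) (.occ 8
   [2, 5, 7, 1, 11, 10, 8, 3])) (.occ 1 [10, 8, 11, 2, 5, 7])) (.split 11 5 (.occ 2 [3, 8, 10, 7, 5,
   11]) (.occ 1 [5, 8, 10, 7, 3, 11]))) (.split 11 8 (.split 11 5 (.occ 4 [3, 8, 10, 11, 7, 5, 2])
   (.occ 1 [3, 8, 11, 7, 5, 2])) (.split 11 5 (.occ 1 [2, 5, 11, 10, 8, 3]) (.split 11 1 (.split 11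
   0 (.split 11 4 (.occ 8 [2, 0, 3, 7, 11, 5, 1, 4]) (.occ 4 [5, 1, 4, 11, 2, 0, 3])) (.occSwap 17
   [8, 11, 2])) (.split 11 0 (.occ 17 [2, 11, 8]) (.undom 11))))))))) (.split 10 5 (.occ 16 [9, 4,
   1, 5, 7, 6, 3, 0, 2, 8, 10]) (.occ 1 [10, 8, 4, 2, 5, 7]))) (.occ 14 [6, 2, 0, 3, 7, 10, 9, 1,
   8]))) (.occ 23 [3, 2, 10, 9, 8])) (.split 10 8 (.occSwap 23 [9, 8, 10, 3, 2]) (.occ 4 [9, 1, 8,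
   10, 2, 0, 3]))) (.occSwap 17 [9, 10, 3])) (.split 10 0 (.occ 17 [3, 10, 9]) (.undom 10)))) (.wit
   3 9 10 (.split 10 1 (.split 10 0 (.split 10 8 (.split 10 7 (.split 10 2 (.occ 11 [9, 1, 8, 10, 7,
   2, 0, 3]) (.occ 9 [2, 0, 3, 7, 10, 9, 1, 8])) (.split 10 2 (.occ 8 [9, 1, 8, 10, 7, 2, 0, 3])
   (.occ 6 [2, 0, 3, 7, 10, 9, 1, 8]))) (.split 10 2 (.split 10 7 (.occ 10 [8, 1, 9, 7, 10, 3, 0,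
   2]) (.occ 7 [8, 1, 9, 7, 10, 3, 0, 2])) (.occ 4 [3, 0, 2, 10, 8, 1, 9]))) (.occSwap 17 [10, 9,
   3])) (.split 10 0 (.occ 17 [10, 3, 9]) (.undom 10))))) (.split 9 7 (.wit 3 9 10 (.split 10 0
   (.split 10 1 (.split 10 4 (.split 10 6 (.split 10 2 (.split 10 7 (.occ 12 [3, 7, 9, 1, 0, 4, 10,
   2]) (.split 10 8 (.split 10 5 (.wit 7 10 11 (.split 11 4 (.split 11 0 (.split 11 2 (.split 11 5
   (.occ 5 [11, 0, 7, 2, 4, 10, 5]) (.split 11 3 (.split 11 6 (.split 11 1 (.split 11 9 (.occ 15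
   [11, 2, 0, 3, 7, 10, 9, 1, 4]) (.occ 2 [1, 11, 3, 9, 2, 10])) (.split 11 8 (.split 11 9 (.wit 1
   11 12 (.split 12 0 (.split 12 5 (.split 12 4 (.occSwap 19 [12, 11, 5, 4]) (.split 12 9 (.occSwap
   19 [11, 12, 4, 9]) (.occSwap 17 [4, 9, 12]))) (.occ 17 [11, 12, 5])) (.undom 12))) (.wit 5 11 12
   (.split 12 0 (.split 12 1 (.split 12 4 (.split 12 10 (.split 12 9 (.split 12 8 (.occ 11 [9, 12,
   0, 10, 4, 5, 8, 11]) (.split 12 2 (.split 12 7 (.occ 12 [7, 0, 11, 2, 12, 5, 10, 4]) (.occ 1 [11,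
   2, 12, 8, 5, 7])) (.split 12 7 (.split 12 3 (.occ 12 [9, 1, 8, 10, 12, 2, 0, 3]) (.occ 1 [8, 5,
   2, 3, 7, 12])) (.occ 2 [0, 12, 4, 7, 9, 2])))) (.split 12 6 (.split 12 2 (.split 12 7 (.occ 12
   [7, 0, 11, 2, 12, 5, 10, 4]) (.occ 11 [7, 0, 11, 2, 12, 5, 10, 4])) (.split 12 8 (.split 12 7
   (.occ 11 [9, 6, 11, 0, 10, 7, 12, 8]) (.occ 1 [2, 5, 7, 11, 8, 12])) (.occ 1 [8, 10, 12, 11, 2,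
   9]))) (.occ 1 [5, 10, 12, 9, 6, 11]))) (.occ 2 [4, 10, 5, 11, 0, 12])) (.split 12 10 (.split 12 7
   (.split 12 2 (.occ 11 [4, 10, 5, 2, 12, 11, 0, 7]) (.occ 8 [4, 10, 5, 2, 12, 11, 0, 7])) (.occ 4
   [5, 10, 4, 12, 7, 0, 11])) (.occ 1 [11, 0, 12, 4, 10, 5]))) (.occ 17 [12, 11, 5])) (.split 12 1
   (.occSwap 17 [5, 12, 11]) (.undom 12))))) (.split 11 9 (.wit 1 11 12 (.split 12 0 (.split 12 5
   (.split 12 8 (.split 12 9 (.split 12 4 (.occ 3 [9, 12, 0, 1, 4, 11]) (.split 12 7 (.occ 5 [9, 1,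
   8, 7, 11, 0, 12]) (.occ 2 [9, 11, 4, 12, 0, 7]))) (.split 12 4 (.wit 5 11 13 (.split 13 0 (.split
   13 1 (.split 13 4 (.split 13 12 (.occ 5 [0, 12, 5, 13, 11, 4, 1]) (.occ 2 [0, 12, 5, 11, 4, 13]))
   (.split 13 12 (.occ 2 [12, 4, 11, 13, 1, 5]) (.occ 1 [4, 12, 5, 11, 0, 13]))) (.occ 17 [11, 13,
   5])) (.split 13 1 (.occSwap 17 [13, 5, 11]) (.undom 13)))) (.occSwap 17 [4, 9, 12]))) (.occ 17
   [11, 12, 8])) (.occ 17 [11, 12, 5])) (.undom 12))) (.occSwap 17 [8, 9, 11])))) (.occ 11 [7, 0,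
   11, 2, 6, 5, 10, 4])) (.occ 2 [0, 10, 5, 3, 4, 11]))) (.split 11 5 (.occ 2 [5, 11, 4, 7, 0, 2])
   (.split 11 9 (.occ 2 [0, 11, 4, 7, 9, 2]) (.split 11 3 (.split 11 1 (.occ 14 [11, 4, 1, 9, 7, 10,
   3, 0, 2]) (.occ 8 [11, 0, 2, 10, 7, 4, 1, 9])) (.occ 2 [0, 10, 5, 3, 4, 11]))))) (.split 11 1
   (.split 11 5 (.split 11 9 (.split 11 8 (.split 11 2 (.split 11 3 (.wit 0 11 12 (.split 12 1
   (.split 12 3 (.split 12 2 (.occ 3 [1, 11, 2, 12, 3, 0]) (.occ 19 [11, 12, 2, 3])) (.split 12 2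
   (.occSwap 19 [2, 3, 12, 11]) (.occ 2 [11, 1, 12, 2, 0, 3]))) (.undom 12))) (.split 11 6 (.wit 0
   11 12 (.split 12 1 (.split 12 2 (.occSwap 21 [11, 12, 2]) (.split 12 8 (.split 12 3 (.split 12 4
   (.split 12 10 (.split 12 7 (.split 12 5 (.split 12 6 (.occ 12 [3, 12, 5, 10, 4, 0, 6, 11])
   (.split 12 9 (.wit 2 12 13 (.split 13 0 (.split 13 1 (.split 13 3 (.split 13 10 (.split 13 11
   (.occ 12 [2, 10, 12, 1, 0, 11, 13, 3]) (.occ 11 [11, 1, 12, 10, 13, 2, 0, 3])) (.split 13 11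
   (.split 13 7 (.split 13 9 (.split 13 4 (.split 13 6 (.split 13 5 (.split 13 8 (.wit 10 13 14
   (.split 14 0 (.split 14 9 (.split 14 3 (.split 14 12 (.split 14 4 (.occ 5 [0, 13, 9, 3, 10, 4,
   14]) (.split 14 2 (.split 14 5 (.split 14 7 (.split 14 6 (.occ 5 [5, 14, 3, 9, 10, 6, 13])
   (.split 14 8 (.occ 5 [13, 8, 10, 3, 9, 14, 0]) (.split 14 1 (.occ 11 [6, 1, 8, 5, 7, 2, 14, 3])
   (.split 14 11 (.occSwap 21 [11, 12, 14]) (.occ 11 [14, 5, 10, 8, 11, 3, 13, 6]))))) (.occ 2 [5,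
   10, 4, 14, 0, 7])) (.occ 2 [13, 0, 14, 4, 10, 5])) (.occ 2 [9, 13, 4, 2, 0, 14]))) (.occ 2 [3,
   12, 10, 14, 9, 13])) (.split 14 4 (.occ 2 [4, 14, 9, 3, 0, 10]) (.split 14 5 (.split 14 6 (.occ 2
   [5, 13, 3, 14, 6, 10]) (.occ 1 [6, 13, 3, 10, 5, 14])) (.occ 1 [4, 10, 5, 3, 0, 14])))) (.split
   14 4 (.occ 2 [0, 13, 9, 10, 4, 14]) (.occ 1 [10, 0, 14, 4, 13, 9]))) (.split 14 1 (.split 14 3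
   (.split 14 12 (.split 14 2 (.split 14 9 (.occ 12 [3, 12, 10, 1, 14, 13, 9, 2]) (.occ 2 [1, 14, 3,
   9, 2, 10])) (.split 14 4 (.split 14 5 (.split 14 9 (.occ 11 [2, 9, 13, 1, 14, 10, 12, 3]) (.occ 1
   [14, 5, 9, 4, 10, 0])) (.occ 2 [10, 4, 14, 5, 13, 0])) (.occ 2 [1, 0, 2, 14, 3, 4]))) (.occSwap
   21 [12, 14, 3])) (.split 14 9 (.split 14 12 (.split 14 2 (.occ 11 [3, 12, 10, 1, 14, 13, 9, 2])
   (.occ 4 [13, 9, 2, 14, 3, 12, 10])) (.occ 1 [13, 9, 14, 3, 12, 10])) (.occSwap 17 [9, 14, 3])))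
   (.undom 14)))) (.occ 11 [2, 5, 8, 1, 7, 6, 13, 3])) (.split 13 8 (.wit 10 13 14 (.split 14 0
   (.split 14 9 (.split 14 4 (.split 14 3 (.occ 5 [0, 13, 9, 3, 10, 4, 14]) (.occ 2 [4, 14, 9, 3, 0,
   10])) (.split 14 2 (.split 14 5 (.split 14 3 (.split 14 12 (.split 14 8 (.occ 5 [13, 0, 10, 3, 9,
   14, 8]) (.split 14 1 (.occ 12 [2, 9, 13, 1, 14, 10, 12, 3]) (.split 14 11 (.occSwap 21 [11, 12,
   14]) (.wit 5 13 15 (.split 15 0 (.split 15 4 (.split 15 9 (.occ 2 [15, 9, 5, 4, 13, 0]) (.split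
   15 10 (.split 15 11 (.split 15 14 (.occ 2 [5, 11, 13, 14, 15, 10]) (.occ 1 [10, 5, 14, 15, 11,
   13])) (.split 15 3 (.split 15 8 (.split 15 7 (.split 15 2 (.split 15 6 (.occ 5 [7, 13, 6, 3, 5,
   8, 15]) (.occ 2 [15, 2, 6, 8, 5, 7])) (.occ 2 [8, 5, 2, 15, 7, 13])) (.split 15 2 (.split 15 1
   (.occ 11 [7, 1, 11, 4, 10, 3, 15, 2]) (.wit 9 15 16 (.split 16 0 (.split 16 8 (.split 16 13
   (.split 16 5 (.split 16 4 (.occ 11 [9, 13, 0, 16, 4, 5, 8, 15]) (.occ 8 [9, 13, 0, 16, 4, 5, 8,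
   15])) (.split 16 4 (.occ 9 [9, 13, 0, 16, 4, 5, 8, 15]) (.occ 6 [5, 8, 15, 4, 16, 9, 13, 0])))
   (.occ 2 [8, 13, 9, 15, 0, 16])) (.split 16 13 (.split 16 5 (.occ 2 [5, 8, 15, 16, 13, 9]) (.occ 1
   [5, 8, 15, 9, 13, 16])) (.occ 1 [8, 13, 9, 15, 0, 16]))) (.split 16 1 (.occSwap 17 [16, 9, 15])
   (.undom 16))))) (.occ 1 [13, 8, 15, 7, 5, 2]))) (.split 15 1 (.split 15 7 (.split 15 2 (.split 15
   12 (.occ 12 [8, 12, 15, 7, 5, 13, 9, 2]) (.occ 2 [3, 15, 2, 13, 1, 12])) (.occ 1 [13, 7, 15, 8,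
   5, 2])) (.occ 1 [15, 3, 7, 10, 8, 11])) (.occSwap 17 [8, 9, 15]))) (.occ 22 [2, 3, 4, 5, 15, 7,
   10, 11]))) (.occ 2 [4, 10, 5, 13, 0, 15]))) (.split 15 9 (.occ 1 [0, 13, 4, 15, 9, 5]) (.split 15
   1 (.split 15 2 (.split 15 10 (.split 15 14 (.split 15 11 (.occ 2 [5, 11, 13, 14, 15, 10]) (.split
   15 3 (.split 15 7 (.split 15 12 (.occ 11 [4, 12, 15, 7, 5, 13, 9, 2]) (.occ 2 [3, 15, 2, 13, 1,
   12])) (.occ 2 [3, 15, 2, 4, 1, 7])) (.occ 1 [11, 4, 3, 5, 10, 15]))) (.occ 1 [14, 0, 15, 9, 13,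
   4])) (.occ 1 [4, 10, 5, 13, 0, 15])) (.occ 1 [2, 0, 15, 9, 13, 4])) (.occSwap 17 [4, 9, 15]))))
   (.split 15 1 (.split 15 14 (.occSwap 21 [15, 5, 14]) (.split 15 4 (.split 15 8 (.split 15 9 (.occ
   1 [4, 13, 0, 15, 9, 5]) (.occ 1 [5, 8, 15, 9, 13, 0])) (.occSwap 17 [8, 15, 14])) (.occSwap 17
   [4, 15, 14]))) (.undom 15))))))) (.occ 2 [3, 12, 10, 14, 9, 13])) (.split 14 12 (.split 14 1
   (.occ 11 [3, 12, 10, 1, 14, 13, 9, 2]) (.occ 21 [3, 14, 12])) (.occ 1 [3, 12, 10, 13, 9, 14])))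
   (.occ 1 [0, 13, 4, 14, 9, 5])) (.occ 2 [9, 13, 4, 14, 0, 2]))) (.split 14 4 (.occ 2 [0, 13, 9,
   14, 4, 10]) (.occ 1 [4, 13, 9, 10, 0, 14]))) (.split 14 1 (.split 14 3 (.split 14 12 (.split 14 2
   (.split 14 9 (.occ 12 [2, 9, 13, 1, 14, 10, 12, 3]) (.occ 2 [1, 14, 3, 9, 2, 10])) (.split 14 4
   (.split 14 5 (.split 14 9 (.occ 11 [2, 9, 13, 1, 14, 10, 12, 3]) (.occ 1 [14, 5, 9, 4, 10, 0]))
   (.occ 1 [0, 10, 5, 13, 4, 14])) (.occ 2 [1, 0, 2, 14, 3, 4]))) (.occSwap 21 [12, 14, 3])) (.split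
   14 9 (.split 14 12 (.split 14 2 (.occ 11 [3, 12, 10, 1, 14, 13, 9, 2]) (.occ 4 [10, 12, 3, 14, 2,
   9, 13])) (.occ 1 [3, 12, 10, 13, 9, 14])) (.occSwap 17 [9, 14, 3]))) (.undom 14)))) (.wit 10 13
   14 (.split 14 0 (.split 14 4 (.split 14 5 (.split 14 9 (.split 14 3 (.occ 5 [0, 14, 9, 3, 10, 4,
   13]) (.occ 2 [4, 14, 9, 3, 0, 10])) (.occ 2 [14, 5, 9, 0, 10, 4])) (.occ 2 [4, 10, 5, 14, 0,
   13])) (.split 14 5 (.split 14 7 (.split 14 9 (.split 14 2 (.split 14 3 (.split 14 12 (.split 14 1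
   (.occ 12 [2, 9, 13, 1, 14, 10, 12, 3]) (.split 14 11 (.occSwap 21 [11, 12, 14]) (.split 14 8
   (.occ 2 [2, 14, 7, 11, 8, 10]) (.occ 1 [8, 11, 13, 10, 2, 14])))) (.occ 2 [3, 12, 10, 14, 9,
   13])) (.split 14 8 (.occ 2 [8, 14, 9, 3, 0, 10]) (.split 14 11 (.occ 1 [13, 11, 14, 3, 8, 10])
   (.occ 1 [8, 11, 13, 10, 2, 14])))) (.occ 2 [9, 13, 4, 2, 0, 14])) (.occ 1 [14, 5, 9, 0, 10, 4]))
   (.occ 2 [5, 10, 4, 14, 0, 7])) (.occ 1 [4, 10, 5, 13, 0, 14]))) (.split 14 1 (.split 14 2 (.split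
   14 11 (.split 14 3 (.split 14 12 (.split 14 9 (.occ 12 [2, 9, 13, 1, 14, 10, 12, 3]) (.occ 2 [1,
   14, 3, 9, 2, 10])) (.occSwap 21 [12, 14, 3])) (.split 14 8 (.occ 11 [3, 8, 10, 1, 14, 13, 11, 2])
   (.occ 1 [13, 11, 14, 3, 8, 10]))) (.occSwap 21 [11, 14, 2])) (.split 14 8 (.split 14 11 (.split
   14 3 (.occ 11 [2, 11, 13, 1, 14, 10, 8, 3]) (.occ 4 [13, 11, 2, 14, 3, 8, 10])) (.occ 1 [2, 11,
   13, 10, 8, 14])) (.occSwap 17 [8, 14, 2]))) (.undom 14)))))) (.occ 5 [4, 13, 0, 11, 12, 9, 6]))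
   (.split 13 6 (.split 13 5 (.occ 12 [5, 13, 3, 0, 1, 2, 6, 4]) (.occ 11 [5, 1, 4, 6, 13, 2, 0,
   3])) (.occ 11 [12, 9, 13, 11, 2, 4, 6, 0]))) (.split 13 4 (.occ 16 [12, 9, 1, 4, 10, 7, 2, 0, 3,
   11, 13]) (.occ 1 [13, 11, 9, 3, 4, 10]))) (.occ 14 [7, 12, 1, 11, 13, 10, 3, 0, 2])) (.occ 8 [11,
   1, 12, 10, 13, 2, 0, 3]))) (.split 13 11 (.split 13 10 (.occ 11 [3, 0, 2, 10, 13, 12, 1, 11])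
   (.occ 8 [3, 0, 2, 10, 13, 12, 1, 11])) (.occ 4 [12, 1, 11, 13, 3, 0, 2]))) (.occ 17 [2, 13, 12]))
   (.split 13 1 (.occSwap 17 [12, 13, 2]) (.undom 13)))) (.wit 2 12 13 (.split 13 0 (.split 13 1
   (.split 13 9 (.split 13 7 (.split 13 3 (.split 13 10 (.occ 12 [12, 1, 9, 13, 10, 3, 0, 2])
   (.split 13 11 (.split 13 4 (.split 13 6 (.split 13 5 (.occ 11 [4, 13, 0, 7, 9, 12, 5, 2]) (.split
   13 8 (.wit 10 13 14 (.split 14 9 (.split 14 7 (.split 14 5 (.split 14 3 (.split 14 11 (.split 14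
   0 (.split 14 4 (.occ 5 [4, 14, 9, 3, 10, 0, 13]) (.split 14 2 (.split 14 1 (.split 14 12 (.occ 15
   [0, 3, 14, 2, 9, 12, 13, 1, 10]) (.occ 2 [1, 14, 2, 13, 3, 12])) (.split 14 12 (.occSwap 21 [12,
   9, 14]) (.wit 4 14 15 (.split 15 0 (.split 15 1 (.split 15 9 (.split 15 13 (.split 15 10 (.split
   15 3 (.occ 12 [9, 13, 4, 3, 15, 14, 0, 10]) (.split 15 2 (.split 15 12 (.split 15 11 (.occ 11
   [12, 15, 0, 13, 9, 4, 11, 14]) (.occ 12 [3, 13, 11, 1, 0, 12, 15, 2])) (.split 15 7 (.split 15 11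
   (.occ 11 [12, 7, 14, 0, 13, 10, 15, 11]) (.occ 1 [11, 13, 15, 14, 3, 12])) (.occ 1 [12, 7, 14, 4,
   13, 15]))) (.occ 11 [3, 0, 2, 10, 15, 4, 1, 9]))) (.split 15 5 (.occ 2 [0, 10, 4, 15, 5, 14])
   (.occ 1 [5, 10, 4, 14, 0, 15]))) (.occ 2 [9, 13, 4, 14, 0, 15])) (.split 15 13 (.split 15 10
   (.split 15 3 (.occ 11 [9, 13, 4, 3, 15, 14, 0, 10]) (.occ 8 [9, 13, 4, 3, 15, 14, 0, 10])) (.occ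
   4 [10, 0, 14, 15, 4, 13, 9])) (.occ 1 [9, 13, 4, 14, 0, 15]))) (.occ 17 [15, 14, 4])) (.split 15
   1 (.occSwap 17 [15, 4, 14]) (.undom 15)))))) (.occ 2 [9, 13, 4, 14, 0, 2]))) (.split 14 1 (.split
   14 12 (.split 14 8 (.split 14 4 (.split 14 2 (.wit 0 14 15 (.split 15 1 (.split 15 2 (.occSwap 21
   [15, 14, 2]) (.split 15 3 (.occSwap 21 [15, 14, 3]) (.occ 2 [14, 1, 15, 2, 0, 3]))) (.undom 15)))
   (.wit 5 13 15 (.split 15 0 (.split 15 9 (.split 15 4 (.occ 2 [13, 9, 5, 4, 15, 0]) (.occ 1 [0,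
   13, 4, 15, 9, 5])) (.split 15 4 (.split 15 10 (.split 15 12 (.split 15 3 (.split 15 8 (.split 15
   7 (.split 15 2 (.occ 5 [5, 7, 13, 12, 2, 15, 8]) (.occ 2 [7, 5, 2, 15, 8, 13])) (.split 15 2
   (.split 15 11 (.split 15 1 (.wit 9 15 16 (.split 16 0 (.split 16 13 (.split 16 2 (.split 16 12
   (.split 16 7 (.split 16 5 (.split 16 8 (.split 16 4 (.occ 11 [9, 13, 0, 16, 4, 5, 8, 15]) (.occ
   11 [4, 13, 9, 7, 0, 12, 16, 2])) (.occ 2 [13, 8, 15, 16, 5, 9])) (.occ 2 [12, 16, 13, 5, 2, 15]))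
   (.occ 2 [12, 7, 9, 15, 0, 16])) (.split 16 1 (.split 16 14 (.occ 2 [9, 14, 12, 13, 16, 2])
   (.split 16 10 (.split 16 3 (.occ 5 [16, 1, 9, 10, 3, 15, 2]) (.occ 2 [2, 15, 3, 16, 1, 9])) (.occ
   1 [16, 2, 10, 13, 9, 14]))) (.occSwap 17 [12, 9, 16]))) (.split 16 1 (.split 16 3 (.split 16 10
   (.split 16 4 (.split 16 8 (.split 16 5 (.occ 11 [9, 13, 0, 16, 4, 5, 8, 15]) (.occ 9 [5, 8, 15,
   4, 16, 9, 13, 0])) (.occ 11 [9, 1, 8, 10, 16, 2, 0, 3])) (.occ 11 [9, 1, 4, 10, 16, 2, 0, 3]))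
   (.split 16 4 (.split 16 5 (.occ 2 [16, 5, 9, 0, 10, 4]) (.split 16 8 (.occ 9 [5, 8, 15, 4, 16, 9,
   13, 0]) (.occ 1 [5, 8, 15, 9, 13, 16]))) (.occ 8 [9, 1, 4, 10, 16, 2, 0, 3]))) (.occ 1 [2, 15, 3,
   9, 1, 16])) (.split 16 4 (.split 16 11 (.occ 21 [16, 2, 11]) (.split 16 12 (.split 16 14 (.split
   16 10 (.occ 2 [16, 10, 2, 14, 1, 13]) (.split 16 5 (.occ 2 [16, 5, 9, 0, 10, 4]) (.occ 12 [5, 10,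
   0, 15, 12, 11, 4, 16]))) (.occ 17 [16, 2, 14])) (.occ 17 [16, 2, 12]))) (.occSwap 17 [4, 9,
   16])))) (.split 16 4 (.occ 2 [4, 13, 9, 15, 0, 16]) (.occ 1 [15, 0, 16, 4, 13, 9]))) (.split 16 1
   (.split 16 3 (.split 16 12 (.split 16 11 (.occ 1 [16, 11, 9, 12, 15, 0]) (.split 16 2 (.occSwap
   21 [11, 16, 2]) (.split 16 8 (.split 16 4 (.split 16 5 (.split 16 13 (.occ 10 [0, 13, 9, 4, 16,
   15, 8, 5]) (.occ 2 [1, 15, 2, 16, 3, 13])) (.occ 1 [11, 15, 0, 5, 12, 16])) (.occ 2 [1, 0, 2, 16,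
   3, 4])) (.occSwap 17 [8, 16, 2])))) (.occSwap 21 [16, 12, 3])) (.occSwap 17 [9, 16, 3])) (.undom
   16)))) (.occSwap 21 [12, 11, 15])) (.split 15 14 (.occ 12 [15, 14, 7, 5, 8, 2, 11, 13]) (.occ 11
   [15, 8, 13, 11, 14, 2, 5, 7]))) (.occ 1 [13, 8, 15, 7, 5, 2]))) (.split 15 1 (.split 15 11 (.occ
   2 [15, 11, 9, 3, 8, 10]) (.split 15 7 (.split 15 2 (.split 15 14 (.occ 12 [2, 5, 8, 14, 9, 15, 7,
   13]) (.occ 2 [3, 15, 2, 13, 1, 14])) (.occ 1 [13, 7, 15, 8, 5, 2])) (.occ 1 [15, 3, 7, 10, 8,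
   11]))) (.occSwap 17 [8, 9, 15]))) (.split 15 11 (.occ 12 [0, 15, 11, 4, 10, 3, 12, 5]) (.occ 11
   [11, 4, 3, 12, 15, 5, 10, 0]))) (.occ 1 [15, 4, 12, 0, 13, 9])) (.occ 2 [0, 10, 5, 15, 4, 13]))
   (.split 15 10 (.split 15 14 (.occ 2 [14, 4, 13, 5, 10, 15]) (.occ 1 [14, 4, 13, 5, 10, 15]))
   (.occ 1 [4, 10, 5, 13, 0, 15])))) (.split 15 1 (.split 15 2 (.split 15 3 (.split 15 6 (.occ 5 [2,
   15, 3, 6, 5, 1, 0]) (.occ 2 [1, 15, 3, 6, 2, 5])) (.occ 2 [1, 0, 3, 5, 2, 15])) (.split 15 8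
   (.split 15 7 (.occ 2 [7, 5, 2, 15, 8, 13]) (.occ 1 [13, 8, 15, 7, 5, 2])) (.occSwap 17 [8, 15,
   2]))) (.undom 15))))) (.occ 11 [9, 13, 0, 3, 4, 14, 8, 10])) (.split 14 2 (.occ 5 [3, 0, 2, 7, 8,
   1, 14]) (.occSwap 17 [8, 14, 2]))) (.occSwap 21 [14, 12, 3])) (.undom 14))) (.split 14 0 (.split
   14 4 (.occ 5 [4, 14, 9, 3, 10, 0, 13]) (.split 14 2 (.split 14 1 (.occ 2 [1, 14, 3, 11, 2, 10])
   (.split 14 12 (.occSwap 21 [12, 9, 14]) (.occSwap 17 [11, 12, 14]))) (.occ 2 [9, 13, 4, 14, 0,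
   2]))) (.split 14 1 (.split 14 2 (.occSwap 21 [11, 14, 2]) (.occ 8 [14, 1, 11, 13, 10, 3, 0, 2]))
   (.undom 14)))) (.split 14 0 (.split 14 4 (.occ 2 [4, 14, 9, 3, 0, 10]) (.split 14 12 (.occ 2 [12,
   14, 9, 3, 0, 10]) (.split 14 2 (.split 14 1 (.occ 14 [14, 2, 0, 3, 13, 10, 9, 1, 12]) (.occ 8
   [14, 0, 3, 13, 10, 9, 1, 12])) (.occ 2 [9, 13, 4, 14, 0, 2])))) (.split 14 1 (.split 14 11
   (.split 14 2 (.split 14 4 (.occ 11 [3, 4, 10, 1, 11, 7, 14, 2]) (.split 14 12 (.occ 16 [12, 14,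
   1, 4, 10, 7, 2, 0, 3, 11, 13]) (.occ 8 [14, 1, 12, 10, 13, 2, 0, 3]))) (.split 14 8 (.split 14 6
   (.occ 2 [14, 6, 2, 7, 13, 8]) (.occ 8 [10, 8, 14, 11, 3, 6, 13, 7])) (.occSwap 17 [8, 14, 2])))
   (.occSwap 17 [14, 11, 3])) (.undom 14)))) (.split 14 11 (.occ 2 [7, 5, 10, 13, 11, 14]) (.occ 1
   [11, 5, 10, 13, 7, 14]))) (.split 14 0 (.split 14 4 (.split 14 3 (.occ 5 [4, 14, 9, 3, 10, 0,
   13]) (.occ 2 [4, 14, 9, 3, 0, 10])) (.split 14 5 (.occ 2 [5, 10, 4, 14, 0, 7]) (.occ 1 [7, 0, 14,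
   5, 10, 4]))) (.split 14 1 (.split 14 2 (.split 14 11 (.split 14 5 (.split 14 4 (.split 14 12
   (.split 14 8 (.split 14 6 (.occ 2 [8, 13, 7, 14, 6, 10]) (.occ 1 [10, 8, 14, 6, 13, 7])) (.occ 1
   [14, 12, 8, 9, 7, 0])) (.occ 1 [9, 13, 0, 14, 4, 12])) (.occ 1 [7, 5, 14, 0, 10, 4])) (.occ 1 [7,
   5, 10, 13, 11, 14])) (.occSwap 21 [11, 14, 2])) (.split 14 8 (.split 14 6 (.occ 1 [14, 6, 2, 8,
   13, 7]) (.occ 1 [10, 8, 14, 6, 13, 7])) (.occSwap 17 [8, 14, 2]))) (.undom 14)))) (.split 14 0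
   (.split 14 4 (.occ 2 [0, 13, 9, 14, 4, 10]) (.occ 1 [4, 13, 9, 10, 0, 14])) (.split 14 1 (.split
   14 3 (.split 14 2 (.occ 2 [1, 14, 3, 9, 2, 10]) (.occ 8 [14, 1, 9, 13, 10, 3, 0, 2])) (.occSwap
   17 [9, 14, 3])) (.undom 14))))) (.occ 18 [3, 2, 9, 8, 7, 10, 11, 12, 13]))) (.occ 2 [13, 4, 12,
   0, 6, 9])) (.occ 18 [3, 2, 9, 4, 7, 10, 11, 12, 13])) (.occ 8 [11, 1, 12, 10, 13, 2, 0, 3])))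
   (.split 13 10 (.occ 11 [3, 0, 2, 10, 13, 12, 1, 9]) (.occ 8 [3, 0, 2, 10, 13, 12, 1, 9]))) (.occ
   2 [0, 7, 12, 2, 9, 13])) (.split 13 3 (.split 13 10 (.occ 11 [9, 1, 12, 10, 13, 2, 0, 3]) (.occ 8
   [9, 1, 12, 10, 13, 2, 0, 3])) (.occ 4 [9, 1, 12, 13, 2, 0, 3]))) (.occ 17 [13, 2, 12])) (.split
   13 1 (.occSwap 17 [12, 13, 2]) (.undom 13)))))) (.occ 2 [10, 5, 11, 0, 7, 12])) (.occ 8 [11, 1,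
   12, 10, 7, 2, 0, 3])) (.split 12 5 (.occ 2 [4, 10, 0, 12, 5, 11]) (.occ 1 [11, 4, 12, 5, 10,
   0]))) (.occ 2 [1, 0, 2, 12, 3, 4])) (.occSwap 17 [12, 11, 3])) (.occSwap 17 [8, 12, 2]))) (.undom
   12))) (.wit 0 11 12 (.split 12 1 (.split 12 2 (.occSwap 21 [11, 12, 2]) (.split 12 3 (.split 12 4
   (.split 12 10 (.split 12 7 (.split 12 5 (.split 12 6 (.occ 11 [11, 4, 3, 12, 6, 5, 10, 0]) (.occ
   8 [11, 4, 3, 12, 6, 5, 10, 0])) (.occ 2 [10, 5, 11, 12, 7, 0])) (.occ 8 [11, 1, 12, 10, 7, 2, 0,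
   3])) (.split 12 5 (.occ 2 [5, 10, 0, 12, 4, 11]) (.occ 1 [5, 10, 0, 11, 4, 12]))) (.occ 2 [1, 0,
   2, 12, 3, 4])) (.occSwap 17 [11, 12, 3]))) (.undom 12))))) (.split 11 3 (.split 11 6 (.occ 11 [2,
   5, 7, 1, 8, 6, 11, 3]) (.wit 0 11 12 (.split 12 1 (.split 12 2 (.split 12 9 (.split 12 3 (.occ 19
   [12, 11, 2, 3]) (.split 12 7 (.split 12 6 (.split 12 4 (.occ 11 [11, 9, 7, 12, 2, 4, 6, 0]) (.occ
   9 [11, 9, 7, 12, 2, 4, 6, 0])) (.occ 8 [11, 1, 12, 7, 6, 3, 0, 2])) (.split 12 6 (.split 12 4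
   (.occ 10 [11, 9, 7, 12, 2, 4, 6, 0]) (.occ 4 [11, 9, 7, 12, 4, 6, 0])) (.occ 7 [11, 1, 12, 7, 6,
   3, 0, 2])))) (.occ 20 [12, 11, 9, 2])) (.occSwap 17 [12, 11, 2])) (.undom 12)))) (.wit 0 11 12
   (.split 12 1 (.split 12 2 (.split 12 3 (.occ 2 [12, 1, 11, 3, 0, 2]) (.occSwap 17 [11, 12, 3]))
   (.occSwap 17 [11, 12, 2])) (.undom 12))))) (.split 11 2 (.occ 8 [7, 5, 11, 2, 8, 0, 10, 4])
   (.occSwap 17 [8, 11, 2]))) (.occ 1 [11, 5, 9, 4, 10, 0])) (.split 11 3 (.split 11 2 (.split 11 6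
   (.occ 5 [2, 11, 3, 6, 5, 1, 0]) (.occ 2 [1, 11, 3, 6, 2, 5])) (.split 11 8 (.split 11 6 (.split
   11 9 (.occ 16 [5, 8, 1, 9, 7, 10, 3, 0, 2, 11, 6]) (.occ 8 [11, 1, 9, 7, 10, 3, 0, 2])) (.occ 8
   [11, 1, 5, 7, 6, 3, 0, 2])) (.occSwap 17 [8, 11, 2]))) (.occ 1 [0, 10, 5, 3, 4, 11]))) (.undom
   11))) (.split 11 0 (.split 11 5 (.occ 2 [5, 10, 4, 11, 0, 7]) (.occ 1 [7, 0, 11, 5, 10, 4]))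
   (.split 11 1 (.split 11 5 (.occ 1 [7, 5, 11, 0, 10, 4]) (.split 11 2 (.split 11 3 (.occ 2 [3, 11,
   2, 4, 1, 7]) (.occ 2 [1, 0, 3, 5, 2, 11])) (.split 11 8 (.occ 0 [4, 8, 11, 7, 5, 2]) (.occSwap 17
   [8, 11, 2])))) (.undom 11))))) (.wit 7 10 11 (.split 11 8 (.split 11 2 (.split 11 5 (.split 11 3
   (.split 11 1 (.occ 12 [10, 8, 3, 11, 1, 2, 5, 7]) (.split 11 0 (.split 11 9 (.split 11 6 (.split
   11 4 (.wit 1 11 12 (.split 12 0 (.split 12 9 (.split 12 4 (.occ 3 [0, 1, 9, 12, 4, 11]) (.split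
   12 2 (.split 12 5 (.split 12 8 (.occ 3 [1, 8, 11, 9, 12, 0]) (.split 12 6 (.split 12 3 (.occ 5
   [11, 5, 1, 2, 3, 12, 6]) (.occ 2 [5, 11, 3, 1, 6, 12])) (.occ 5 [9, 1, 8, 6, 12, 0, 11]))) (.occ
   2 [1, 0, 12, 5, 11, 4])) (.occ 2 [9, 1, 4, 2, 0, 12]))) (.split 12 4 (.split 12 8 (.split 12 5
   (.occ 3 [5, 11, 0, 12, 4, 1]) (.split 12 10 (.split 12 6 (.split 12 7 (.occ 5 [1, 8, 11, 10, 7,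
   12, 6]) (.occ 2 [6, 1, 7, 11, 8, 12])) (.occ 5 [0, 1, 5, 6, 12, 4, 11])) (.occ 2 [0, 11, 5, 10,
   4, 12]))) (.occSwap 17 [8, 9, 12])) (.occSwap 17 [4, 9, 12]))) (.undom 12))) (.wit 1 11 12
   (.split 12 0 (.split 12 4 (.split 12 7 (.split 12 5 (.occ 5 [0, 12, 4, 7, 11, 5, 1]) (.split 12 9
   (.occ 5 [1, 0, 11, 7, 4, 12, 9]) (.split 12 8 (.split 12 6 (.occ 5 [8, 1, 7, 4, 11, 6, 12])
   (.split 12 2 (.occ 2 [12, 2, 6, 8, 5, 7]) (.wit 9 12 13 (.split 13 0 (.split 13 1 (.split 13 2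
   (.split 13 7 (.split 13 4 (.occ 12 [4, 13, 2, 0, 1, 12, 7, 9]) (.occ 11 [4, 1, 9, 7, 13, 12, 0,
   2])) (.split 13 8 (.split 13 11 (.occ 5 [0, 1, 9, 13, 12, 8, 11]) (.occ 2 [8, 11, 9, 13, 0, 12]))
   (.occ 8 [8, 1, 9, 7, 13, 12, 0, 2]))) (.split 13 8 (.split 13 11 (.occ 5 [0, 1, 9, 13, 12, 8,
   11]) (.occ 2 [8, 11, 9, 13, 0, 12])) (.occ 4 [2, 0, 12, 13, 9, 1, 8]))) (.occ 17 [13, 12, 9]))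
   (.split 13 1 (.occSwap 17 [9, 13, 12]) (.undom 13)))))) (.occSwap 17 [8, 9, 12])))) (.split 12 3
   (.split 12 5 (.occ 2 [0, 12, 4, 7, 5, 11]) (.split 12 6 (.split 12 8 (.occ 2 [8, 1, 7, 11, 6,
   12]) (.occ 1 [11, 6, 12, 8, 1, 7])) (.occ 1 [7, 3, 12, 5, 11, 6]))) (.occ 1 [1, 4, 12, 7, 3,
   11]))) (.occ 17 [11, 12, 4])) (.undom 12)))) (.occ 2 [9, 11, 8, 7, 0, 6])) (.split 11 4 (.split
   11 6 (.occ 1 [9, 6, 10, 5, 11, 3]) (.occ 11 [7, 0, 11, 2, 10, 9, 6, 4])) (.occSwap 17 [4, 9,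
   11]))) (.undom 11))) (.split 11 1 (.occ 11 [3, 8, 10, 1, 11, 7, 5, 2]) (.occ 8 [3, 8, 10, 1, 11,
   7, 5, 2]))) (.occ 2 [8, 5, 7, 10, 2, 11])) (.split 11 5 (.split 11 3 (.split 11 1 (.occ 11 [2, 5,
   7, 1, 11, 10, 8, 3]) (.occ 8 [2, 5, 7, 1, 11, 10, 8, 3])) (.occ 4 [2, 5, 7, 11, 10, 8, 3])) (.occ
   1 [2, 5, 7, 10, 8, 11]))) (.split 11 5 (.split 11 3 (.occ 2 [3, 8, 10, 7, 5, 11]) (.occ 1 [7, 5,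
   11, 3, 8, 10])) (.split 11 2 (.occ 1 [10, 2, 11, 8, 5, 7]) (.split 11 3 (.occ 1 [5, 8, 10, 7, 3,
   11]) (.split 11 0 (.split 11 1 (.split 11 4 (.occ 8 [2, 0, 3, 7, 11, 5, 1, 4]) (.occ 4 [5, 1, 4,
   11, 2, 0, 3])) (.occ 17 [2, 11, 8])) (.split 11 1 (.occSwap 17 [8, 11, 2]) (.undom 11)))))))))
   (.occ 8 [8, 1, 9, 7, 10, 3, 0, 2]))) (.split 10 7 (.occ 11 [2, 0, 3, 7, 10, 9, 1, 4]) (.occ 8 [2,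
   0, 3, 7, 10, 9, 1, 4]))) (.occ 2 [0, 6, 9, 10, 4, 3])) (.split 10 2 (.split 10 7 (.occ 11 [4, 1,
   9, 7, 10, 3, 0, 2]) (.occ 8 [4, 1, 9, 7, 10, 3, 0, 2])) (.occ 4 [4, 1, 9, 10, 3, 0, 2]))) (.occ
   17 [3, 10, 9])) (.split 10 1 (.occSwap 17 [9, 10, 3]) (.undom 10)))) (.wit 3 9 10 (.split 10 1
   (.split 10 0 (.split 10 4 (.split 10 7 (.split 10 2 (.occ 11 [9, 1, 4, 10, 7, 2, 0, 3]) (.occ 9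
   [9, 1, 4, 10, 7, 2, 0, 3])) (.split 10 5 (.occ 1 [7, 5, 9, 0, 10, 4]) (.split 10 8 (.occ 1 [7, 5,
   9, 3, 8, 10]) (.split 10 2 (.occ 8 [9, 1, 4, 10, 7, 2, 0, 3]) (.occ 4 [9, 1, 8, 10, 2, 0, 3])))))
   (.split 10 2 (.split 10 7 (.occ 10 [9, 1, 4, 10, 7, 2, 0, 3]) (.occ 7 [4, 1, 9, 7, 10, 3, 0, 2]))
   (.occ 4 [2, 0, 3, 10, 9, 1, 4]))) (.occSwap 17 [9, 10, 3])) (.split 10 0 (.occ 17 [3, 10, 9])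
   (.undom 10)))))) (.split 9 7 (.occ 8 [8, 1, 9, 7, 6, 3, 0, 2]) (.occ 7 [8, 1, 9, 7, 6, 3, 0,
   2]))) (.occ 2 [1, 0, 3, 5, 2, 9]))) (.occSwap 17 [8, 9, 2])) (.undom 9)))

/-- Witnesses give nonadjacent private neighbours `2, 3` of `1` and `4, 5` of `0`. By
`refutedPattern1` and `refutedPattern5` they are joined by a perfect matching; the two main branches
differ by exchanging `2` and `3`. With edges `24` and `35`, a vertex `6` missed by `3, 4` and a
vertex `7` missed by `2, 5` are common neighbours of the ends, adjacent to `2, 5` and to `3, 4`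
respectively: other adjacencies give `G5` or `refutedPattern7`. If `6` and `7` are adjacent, `G13`
appears. Otherwise they miss a vertex `8`: as a common neighbour of the ends it leads to `G3`, `G5`,
`G14`, `G15`, `G16` or `refutedPattern7`, and as a private neighbour to one of the refuted
configurations, notably `refutedPattern9`. -/
def refutedEmptyPattern : Pattern × Refutation :=
  (⟨[],
     []⟩,
   .wit 0 0 2 (.split 2 1 (.wit 0 2 3 (.split 3 1 (.wit 1 1 4 (.split 4 0 (.split 4 2 (.split 4 3
   (.occSwap 21 [3, 2, 4]) (.wit 1 4 5 (.split 5 0 (.split 5 2 (.occ 21 [5, 4, 2]) (.split 5 3 (.wit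
   3 4 6 (.split 6 0 (.split 6 1 (.split 6 2 (.split 6 5 (.wit 2 5 7 (.split 7 0 (.split 7 1 (.split
   7 3 (.split 7 4 (.split 7 6 (.occ 12 [3, 7, 4, 0, 1, 5, 6, 2]) (.wit 6 7 8 (.split 8 0 (.split 8
   1 (.split 8 2 (.split 8 3 (.split 8 4 (.split 8 5 (.occ 15 [8, 3, 1, 2, 6, 7, 5, 0, 4]) (.occ 2
   [3, 8, 2, 5, 0, 7])) (.occ 2 [2, 8, 3, 4, 0, 6])) (.split 8 4 (.split 8 5 (.occ 2 [5, 8, 4, 6, 1,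
   3]) (.occ 14 [8, 2, 1, 3, 7, 6, 4, 0, 5])) (.split 8 5 (.occ 13 [8, 4, 0, 5, 6, 7, 2, 1, 3])
   (.occSwap 23 [3, 2, 8, 4, 5])))) (.split 8 4 (.split 8 5 (.occ 2 [4, 8, 5, 2, 1, 7]) (.split 8 3
   (.occ 13 [7, 5, 0, 4, 8, 6, 3, 1, 2]) (.occ 23 [5, 4, 8, 2, 3]))) (.split 8 3 (.split 8 5 (.occ
   14 [8, 3, 1, 2, 6, 7, 5, 0, 4]) (.occSwap 23 [2, 3, 8, 5, 4])) (.split 8 5 (.occ 23 [4, 5, 8, 3,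
   2]) (.occ 4 [3, 1, 2, 8, 5, 0, 4]))))) (.split 8 2 (.split 8 3 (.occSwap 21 [3, 2, 8]) (.split 8
   4 (.split 8 5 (.occSwap 25 [3, 2, 4, 5, 7, 6, 8]) (.occSwap 23 [2, 3, 7, 5, 8])) (.occ 21 [8, 4,
   2]))) (.split 8 3 (.split 8 5 (.split 8 4 (.occSwap 25 [2, 3, 5, 4, 6, 7, 8]) (.occSwap 23 [3, 2,
   6, 4, 8])) (.occ 17 [5, 8, 2])) (.occSwap 17 [3, 2, 8])))) (.split 8 1 (.split 8 4 (.split 8 2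
   (.split 8 5 (.occ 21 [4, 5, 8]) (.split 8 3 (.occ 25 [5, 4, 2, 3, 6, 7, 8]) (.occ 23 [4, 5, 6, 3,
   8]))) (.occSwap 21 [8, 2, 4])) (.split 8 3 (.split 8 5 (.split 8 2 (.occ 25 [4, 5, 3, 2, 7, 6,
   8]) (.occ 23 [5, 4, 7, 2, 8])) (.occ 17 [4, 5, 8])) (.occSwap 17 [8, 3, 4]))) (.undom 8)))))
   (.occSwap 23 [2, 3, 7, 5, 4])) (.split 7 4 (.occ 23 [5, 4, 7, 2, 3]) (.occ 4 [3, 1, 2, 7, 5, 0,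
   4]))) (.occ 17 [5, 7, 2])) (.split 7 1 (.occSwap 17 [2, 7, 5]) (.undom 7)))) (.occSwap 23 [3, 2,
   6, 4, 5])) (.split 6 5 (.occ 23 [4, 5, 6, 3, 2]) (.occ 4 [3, 1, 2, 6, 5, 0, 4]))) (.occ 17 [6, 4,
   3])) (.split 6 1 (.occSwap 17 [6, 3, 4]) (.undom 6)))) (.occSwap 17 [3, 2, 5]))) (.undom 5))))
   (.split 4 3 (.wit 1 4 5 (.split 5 0 (.split 5 2 (.split 5 3 (.occSwap 21 [3, 2, 5]) (.wit 3 5 6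
   (.split 6 0 (.split 6 1 (.split 6 2 (.split 6 4 (.wit 2 4 7 (.split 7 0 (.split 7 1 (.split 7 3
   (.split 7 5 (.split 7 6 (.occ 12 [3, 7, 5, 0, 1, 4, 6, 2]) (.wit 6 7 8 (.split 8 0 (.split 8 1
   (.split 8 2 (.split 8 3 (.split 8 5 (.split 8 4 (.occ 15 [0, 4, 8, 5, 2, 3, 6, 1, 7]) (.occ 2 [3,
   8, 2, 4, 0, 7])) (.occ 2 [2, 8, 3, 5, 0, 6])) (.split 8 4 (.split 8 5 (.occ 2 [4, 8, 5, 6, 1, 3])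
   (.occ 13 [8, 5, 0, 4, 6, 7, 2, 1, 3])) (.split 8 5 (.occ 14 [8, 2, 1, 3, 7, 6, 5, 0, 4])
   (.occSwap 23 [3, 2, 8, 5, 4])))) (.split 8 4 (.split 8 5 (.occ 2 [5, 8, 4, 2, 1, 7]) (.split 8 3
   (.occ 14 [8, 3, 1, 2, 6, 7, 4, 0, 5]) (.occ 23 [5, 4, 8, 3, 2]))) (.split 8 3 (.split 8 5 (.occ
   13 [7, 4, 0, 5, 8, 6, 3, 1, 2]) (.occSwap 23 [2, 3, 8, 4, 5])) (.split 8 5 (.occ 23 [4, 5, 8, 2,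
   3]) (.occ 4 [3, 1, 2, 8, 4, 0, 5]))))) (.split 8 2 (.split 8 3 (.occSwap 21 [3, 2, 8]) (.split 8
   5 (.split 8 4 (.occSwap 25 [3, 2, 5, 4, 7, 6, 8]) (.occSwap 23 [2, 3, 7, 4, 8])) (.occ 21 [5, 8,
   2]))) (.split 8 3 (.split 8 4 (.split 8 5 (.occSwap 25 [2, 3, 4, 5, 6, 7, 8]) (.occSwap 23 [3, 2,
   6, 5, 8])) (.occ 17 [8, 4, 2])) (.occSwap 17 [3, 2, 8])))) (.split 8 1 (.split 8 4 (.split 8 3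
   (.split 8 5 (.occ 21 [4, 5, 8]) (.split 8 2 (.occ 25 [5, 4, 3, 2, 7, 6, 8]) (.occ 23 [4, 5, 7, 2,
   8]))) (.occSwap 21 [8, 3, 4])) (.split 8 2 (.split 8 5 (.split 8 3 (.occ 25 [4, 5, 2, 3, 6, 7,
   8]) (.occ 23 [5, 4, 6, 3, 8])) (.occ 17 [4, 5, 8])) (.occSwap 17 [8, 2, 4]))) (.undom 8)))))
   (.occSwap 23 [2, 3, 7, 4, 5])) (.split 7 5 (.occ 23 [4, 5, 7, 2, 3]) (.occ 4 [3, 1, 2, 7, 4, 0,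
   5]))) (.occ 17 [7, 4, 2])) (.split 7 1 (.occSwap 17 [7, 2, 4]) (.undom 7)))) (.occSwap 23 [3, 2,
   6, 5, 4])) (.split 6 4 (.occ 23 [5, 4, 6, 3, 2]) (.occ 4 [3, 1, 2, 6, 4, 0, 5]))) (.occ 17 [5, 6,
   3])) (.split 6 1 (.occSwap 17 [3, 6, 5]) (.undom 6))))) (.occ 17 [5, 4, 2])) (.undom 5)))
   (.occSwap 17 [3, 2, 4]))) (.undom 4))) (.undom 3))) (.undom 2)))

/-- A sequence of refuted patterns that ends with the empty pattern. -/
def refutedPatterns : List (Pattern × Refutation) :=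
  [refutedPattern1, refutedPattern2, refutedPattern3, refutedPattern4, refutedPattern5,
  refutedPattern6, refutedPattern7, refutedPattern8, refutedPattern9, refutedEmptyPattern]

/-! ### Evaluation of the case analysis and of the seventeen graphs -/

instance (n : ℕ) (l : List (Fin n × Fin n)) : DecidableRel (graphOfEdges n l).Adj :=
  inferInstanceAs (DecidableRel (SimpleGraph.fromRel fun a b => (a, b) ∈ l).Adj)

instance : ∀ j : Fin 17, DecidableRel (forbidden j).2.Adj
  | 0 | 1 | 2 | 3 | 4 | 5 | 6 | 7 | 8 | 9 | 10 | 11 | 12 | 13 | 14 | 15 | 16 =>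
    inferInstanceAs (DecidableRel (graphOfEdges _ _).Adj)
  | ⟨_ + 17, h⟩ => absurd h (by omega)

/-- The patterns of the seventeen graphs. -/
def forbiddenPatterns : List Pattern :=
  (List.finRange 17).map fun j => Pattern.ofGraph (forbidden j).2

theorem checkAll_refutedPatterns :
    Refutation.checkAll forbiddenPatterns refutedPatterns = true := by
  decide +kernel

/-- A graph with a dominating edge, but without an independent dominating set of at most two
vertices, contains one of the seventeen graphs. -/
theorem not_isDominatingEdge {V : Type*} {G : SimpleGraph V} (hG : NoIndepDominatingPair G)
    (h : ∀ j, ¬ (forbidden j).2.IsIndContained G) (u v : V) : ¬ IsDominatingEdge G u v := by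
  intro huv
  have henv : ∀ P ∈ forbiddenPatterns, P.Excluded G := by
    intro P hP
    obtain ⟨j, -, rfl⟩ := List.mem_map.1 hP
    exact Pattern.excluded_ofGraph (h j)
  have hempty := Refutation.excluded_of_checkAll hG henv _ checkAll_refutedPatterns
    refutedEmptyPattern (by simp [refutedPatterns])
  -- The empty pattern constrains only the images of `0` and `1`; all other names may go to `v`.
  exact hempty (fun i => i.casesOn u fun _ => v) huv ⟨by simp [refutedEmptyPattern],
    by simp [refutedEmptyPattern]⟩

theorem forbidden_noIndepDominatingPair :
    ∀ j, NoIndepDominatingPair (forbidden j).2 := by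
  unfold NoIndepDominatingPair
  decide +kernel

theorem exists_forbidden_isDominatingEdge :
    ∀ j, ∃ u v, IsDominatingEdge (forbidden j).2 u v := by
  unfold IsDominatingEdge
  decide +kernel

/-! ### Domination numbers and basic obstructions -/

section Numbers

variable {V : Type*} {G : SimpleGraph V}

theorem dominationNumber_le {D : Finset V} (hD : IsDominating G D) : dominationNumber G ≤ D.card :=
  Nat.sInf_le ⟨D, hD, rfl⟩

theorem independentDominationNumber_le {D : Finset V}
    (hD : Maximal (fun S : Finset V => G.IsIndepSet (S : Set V)) D) :
    independentDominationNumber G ≤ D.card :=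
  Nat.sInf_le ⟨D, hD, rfl⟩

theorem maximal_isIndepSet_iff {D : Finset V} :
    Maximal (fun S : Finset V => G.IsIndepSet (S : Set V)) D ↔
      G.IsIndepSet (D : Set V) ∧ IsDominating G D := by
  classical
  constructor
  · intro h
    refine ⟨h.prop, fun x => ?_⟩
    by_contra! hx
    refine hx.1 (h.le_of_ge (y := insert x D) ?_ (Finset.subset_insert x D)
      (Finset.mem_insert_self x D))
    rw [Finset.coe_insert]
    exact h.prop.insert fun y hy _ => ⟨fun hxy => hx.2 y hy hxy.symm, hx.2 y hy⟩
  · rintro ⟨hind, hdom⟩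
    refine ⟨hind, fun E hE hDE x hx => ?_⟩
    rcases hdom x with hxD | ⟨y, hy, hyx⟩
    · exact hxD
    · exact absurd hyx (hE (hDE hy) hx hyx.ne)

theorem dominationNumber_le_two {u v : V} (h : IsDominatingEdge G u v) :
    dominationNumber G ≤ 2 := by
  classical
  refine (dominationNumber_le (D := {u, v}) fun x => Or.inr ?_).trans Finset.card_le_two
  rcases h.2 x with hx | hx
  exacts [⟨u, by simp, hx⟩, ⟨v, by simp, hx⟩]

variable [Finite V]

theorem exists_isDominating_card (G : SimpleGraph V) :
    ∃ D : Finset V, IsDominating G D ∧ D.card = dominationNumber G := by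
  have := Fintype.ofFinite V
  exact Nat.sInf_mem (s := {n | ∃ D : Finset V, IsDominating G D ∧ D.card = n})
    ⟨_, Finset.univ, fun x => Or.inl (Finset.mem_univ x), rfl⟩

theorem exists_maximal_isIndepSet_card (G : SimpleGraph V) :
    ∃ D : Finset V, Maximal (fun S : Finset V => G.IsIndepSet (S : Set V)) D ∧
      D.card = independentDominationNumber G := by
  have := Fintype.ofFinite V
  obtain ⟨D, hD⟩ := (Set.toFinite {S : Finset V | G.IsIndepSet (S : Set V)}).exists_maximal
    ⟨∅, by simp⟩
  exact Nat.sInf_mem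
    (s := {n | ∃ D : Finset V, Maximal (fun S : Finset V => G.IsIndepSet (S : Set V)) D ∧
      D.card = n}) ⟨_, D, hD, rfl⟩

theorem dominationNumber_le_independentDominationNumber (G : SimpleGraph V) :
    dominationNumber G ≤ independentDominationNumber G := by
  obtain ⟨D, hD, hcard⟩ := exists_maximal_isIndepSet_card G
  exact hcard ▸ dominationNumber_le (maximal_isIndepSet_iff.1 hD).2

/-- A maximal independent set with at most two vertices would be an independent dominating pair,
possibly with equal entries. Nonemptiness is needed: on no vertices the hypothesis is vacuous and
the number is `0`. -/
theorem two_lt_independentDominationNumber [Nonempty V] (h : NoIndepDominatingPair G) :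
    2 < independentDominationNumber G := by
  classical
  obtain ⟨D, hD, hcard⟩ := exists_maximal_isIndepSet_card G
  obtain ⟨hind, hdom⟩ := maximal_isIndepSet_iff.1 hD
  rw [← hcard]
  by_contra! hle
  obtain ⟨x, y, hxy⟩ : ∃ x y, D = {x, y} := by
    interval_cases hc : D.card
    · rw [Finset.card_eq_zero] at hc
      obtain ⟨x⟩ := ‹Nonempty V›
      simpa [hc] using hdom x
    · obtain ⟨x, rfl⟩ := Finset.card_eq_one.1 hc
      exact ⟨x, x, by simp⟩
    · obtain ⟨x, y, -, rfl⟩ := Finset.card_eq_two.1 hc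
      exact ⟨x, y, rfl⟩
  subst hxy
  obtain ⟨w, hwx, hwy, hxw, hyw⟩ := h x y fun hadj => hind (by simp) (by simp) hadj.ne hadj
  rcases hdom w with hw | ⟨z, hz, hzw⟩
  · simp [hwx, hwy] at hw
  · rcases Finset.mem_insert.1 hz with rfl | hz
    · exact hxw hzw
    · exact hyw (Finset.mem_singleton.1 hz ▸ hzw)

end Numbers

/-! ### Induced copies of basic obstructions -/

theorem IsDominatingEdge.map {V W : Type*} {G : SimpleGraph V} {H : SimpleGraph W} (e : G ≃g H)
    {u v : V} (h : IsDominatingEdge G u v) : IsDominatingEdge H (e u) (e v) := by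
  refine ⟨e.map_adj_iff.2 h.1, fun w => ?_⟩
  obtain ⟨w, rfl⟩ := e.surjective w
  simpa [e.map_adj_iff] using h.2 w

theorem NoIndepDominatingPair.map {V W : Type*} {G : SimpleGraph V} {H : SimpleGraph W}
    (e : G ≃g H) (h : NoIndepDominatingPair G) : NoIndepDominatingPair H := by
  intro x y hxy
  obtain ⟨x, rfl⟩ := e.surjective x
  obtain ⟨y, rfl⟩ := e.surjective y
  obtain ⟨w, hw⟩ := h x y (by rwa [e.map_adj_iff] at hxy)
  exact ⟨e w, by simpa [e.map_adj_iff] using hw⟩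

/-- The induced copy of `H` in `G` has domination number at most `2`, but independent domination
number greater than `2`. -/
theorem not_isDominationPerfect {V W : Type*} [Finite V] {G : SimpleGraph V} {H : SimpleGraph W}
    (hHG : H.IsIndContained G) {u v : W} (huv : IsDominatingEdge H u v)
    (hH : NoIndepDominatingPair H) : ¬ IsDominationPerfect G := by
  intro hG
  obtain ⟨φ⟩ := hHG
  let e : H ≃g G.induce (Set.range φ) :=
    ⟨Equiv.ofInjective φ φ.injective, fun {a b} => φ.map_adj_iff⟩
  have : Nonempty (Set.range φ) := ⟨e u⟩
  have h1 := dominationNumber_le_two (huv.map e)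
  have h2 := two_lt_independentDominationNumber (hH.map e)
  have h3 := hG (Set.range φ)
  omega

/-! ### Exchanging an edge of a dominating set -/

section Exchange

variable {V : Type*} [DecidableEq V] {G : SimpleGraph V}

/-- The vertices that are dominated by no vertex of `D` other than `u` and `v`, together with
`u` and `v`. -/
def residue (G : SimpleGraph V) (D : Finset V) (u v : V) : Set V :=
  {x | x = u ∨ x = v ∨ x ∉ D ∧ ∀ d ∈ D, d ≠ u → d ≠ v → ¬ G.Adj d x}

/-- A vertex of the residue outside `D` still has a neighbour in `D`, which can only be `u` or `v`.
-/
theorem isDominatingEdge_residue {D : Finset V} (hD : IsDominating G D) {u v : V}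
    (huv : G.Adj u v) : IsDominatingEdge (G.induce (residue G D u v)) ⟨u, Or.inl rfl⟩
      ⟨v, Or.inr (Or.inl rfl)⟩ := by
  refine ⟨huv, ?_⟩
  rintro ⟨w, rfl | rfl | ⟨hw, hw'⟩⟩
  · exact Or.inr huv.symm
  · exact Or.inl huv
  · rcases hD w with h | ⟨d, hd, hdw⟩
    · exact absurd h hw
    · by_cases hdu : d = u
      · exact Or.inl (hdu ▸ hdw)
      · by_cases hdv : d = v
        · exact Or.inr (hdv ▸ hdw)
        · exact absurd hdw (hw' d hd hdu hdv)

/-- If an independent pair dominates the residue of an edge `uv` of `D`, then exchanging `u` and `v`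
for this pair gives a dominating set with fewer edges. -/
theorem exists_isDominating_fewer_edges [DecidableRel G.Adj] {D : Finset V}
    {u v : V} (hu : u ∈ D) (hv : v ∈ D) (huv : G.Adj u v)
    (h : ¬ NoIndepDominatingPair (G.induce (residue G D u v))) :
    ∃ E : Finset V, IsDominating G E ∧ E.card ≤ D.card ∧
      ((E ×ˢ E).filter fun p => G.Adj p.1 p.2) ⊂ (D ×ˢ D).filter fun p => G.Adj p.1 p.2 := by
  simp only [NoIndepDominatingPair] at h
  push Not at h
  obtain ⟨⟨x, hx⟩, ⟨y, hy⟩, hxy, hdom⟩ := h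
  replace hxy : ¬ G.Adj x y := hxy
  replace hdom (w : V) (hw : w ∈ residue G D u v) :
      w = x ∨ w = y ∨ G.Adj x w ∨ G.Adj y w := by
    by_contra! hcon
    exact hcon.2.2.2 (hdom ⟨w, hw⟩ (by simpa using hcon.1) (by simpa using hcon.2.1) hcon.2.2.1)
  set D₀ := (D.erase u).erase v with hD₀
  have hmem₀ (d : V) : d ∈ D₀ ↔ d ≠ v ∧ d ≠ u ∧ d ∈ D := by simp [hD₀]
  have hcard₀ : D₀.card + 2 = D.card := by
    have h1 := Finset.card_erase_add_one hu
    have h2 := Finset.card_erase_add_one (Finset.mem_erase.2 ⟨huv.ne', hv⟩)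
    rw [← hD₀] at h2
    omega
  have hres (p q : V) (hp : p ∈ residue G D u v) (hpD : p ∉ D) (hq : q ∈ D₀) :
      ¬ G.Adj q p := by
    obtain ⟨hqv, hqu, hqD⟩ := (hmem₀ q).1 hq
    rcases hp with rfl | rfl | hp
    exacts [absurd hu hpD, absurd hv hpD, hp.2 q hqD hqu hqv]
  have hE (p : V) : p ∈ insert x (insert y D₀) ↔ p = x ∨ p = y ∨ p ∈ D₀ := by simp
  -- No edge of the new set leaves `D`: an end outside `D` would be `x` or `y`, a vertex of the
  -- residue without neighbours in `D₀`, and `x, y` are not adjacent. Should `x` or `y` equal `u` or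
  -- `v`, its edges to `D₀` were already edges of `D`.
  have hedge (p q : V) (hp : p ∈ insert x (insert y D₀)) (hq : q ∈ insert x (insert y D₀))
      (hpq : G.Adj p q) : p ∈ D := by
    by_contra hpD
    have hp' : p = x ∨ p = y := by
      rcases (hE p).1 hp with h | h | h
      exacts [Or.inl h, Or.inr h, absurd ((hmem₀ p).1 h).2.2 hpD]
    have hpr : p ∈ residue G D u v := by rcases hp' with rfl | rfl <;> assumption
    rcases (hE q).1 hq with rfl | rfl | hq
    · rcases hp' with rfl | rfl
      exacts [hpq.ne rfl, hxy hpq.symm]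
    · rcases hp' with rfl | rfl
      exacts [hxy hpq, hpq.ne rfl]
    · exact hres p q hpr hpD hq hpq.symm
  refine ⟨insert x (insert y D₀), fun w => ?_, ?_, ?_⟩
  · by_cases hw : w ∈ residue G D u v
    · rcases hdom w hw with h | h | h | h
      · exact Or.inl ((hE w).2 (Or.inl h))
      · exact Or.inl ((hE w).2 (Or.inr (Or.inl h)))
      · exact Or.inr ⟨x, by simp, h⟩
      · exact Or.inr ⟨y, by simp, h⟩
    -- A vertex outside the residue lies in `D₀` or has a neighbour there.
    · simp only [residue, Set.mem_ofPred_eq, not_or, not_and] at hw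
      by_cases hwD : w ∈ D
      · exact Or.inl ((hE w).2 (Or.inr (Or.inr ((hmem₀ w).2 ⟨hw.2.1, hw.1, hwD⟩))))
      · have := hw.2.2 hwD
        push Not at this
        obtain ⟨d, hd, hdu, hdv, hdw⟩ := this
        exact Or.inr ⟨d, (hE d).2 (Or.inr (Or.inr ((hmem₀ d).2 ⟨hdv, hdu, hd⟩))), hdw⟩
  · have h1 := Finset.card_insert_le x (insert y D₀)
    have h2 := Finset.card_insert_le y D₀
    omega
  -- The edge `uv` itself is lost: neither end is in `D₀`, so both could survive only as `x` and
  -- `y`, which are equal or nonadjacent.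
  · refine (Finset.ssubset_iff_of_subset ?_).2 ⟨(u, v), by simp [hu, hv, huv], ?_⟩
    · rintro ⟨p, q⟩ hpq
      simp only [Finset.mem_filter, Finset.mem_product] at hpq ⊢
      exact ⟨⟨hedge p q hpq.1.1 hpq.1.2 hpq.2, hedge q p hpq.1.2 hpq.1.1 hpq.2.symm⟩, hpq.2⟩
    · simp only [Finset.mem_filter, Finset.mem_product, hE, hmem₀, not_and]
      rintro ⟨hu', hv'⟩ -
      have hu'' : u = x ∨ u = y := by tauto
      have hv'' : v = x ∨ v = y := by tauto
      rcases hu'' with rfl | rfl <;> rcases hv'' with rfl | rfl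
      exacts [huv.ne rfl, hxy huv, hxy huv.symm, huv.ne rfl]

end Exchange

theorem dominationNumber_eq_of_forall_not_isIndContained {V : Type*} [Finite V]
    {G : SimpleGraph V} (h : ∀ j, ¬ (forbidden j).2.IsIndContained G) :
    dominationNumber G = independentDominationNumber G := by
  classical
  refine (dominationNumber_le_independentDominationNumber G).antisymm ?_
  have := Fintype.ofFinite V
  -- A minimum dominating set spanning the fewest edges, counted as ordered pairs; it turns out to
  -- be independent.
  obtain ⟨D, hDmem, hmin⟩ := Finset.exists_min_image
    (Finset.univ.filter fun D : Finset V => IsDominating G D ∧ D.card = dominationNumber G)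
    (fun D => ((D ×ˢ D).filter fun p => G.Adj p.1 p.2).card)
    (by simpa [Finset.Nonempty] using exists_isDominating_card G)
  obtain ⟨hD, hcard⟩ := (Finset.mem_filter.1 hDmem).2
  rw [← hcard]
  refine independentDominationNumber_le (maximal_isIndepSet_iff.2 ⟨?_, hD⟩)
  intro u hu v hv _ huv
  by_cases hres : NoIndepDominatingPair (G.induce (residue G D u v))
  · exact not_isDominatingEdge hres
      (fun j hj => h j (hj.trans ⟨SimpleGraph.Embedding.induce _⟩)) _ _
      (isDominatingEdge_residue hD huv)
  · obtain ⟨E, hE, hEcard, hEdges⟩ := exists_isDominating_fewer_edges hu hv huv hres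
    -- The exchanged set is again of minimum size, so it competes with `D` in the choice above.
    have hEcard' : E.card = dominationNumber G :=
      (hEcard.trans_eq hcard).antisymm (dominationNumber_le hE)
    exact (Finset.card_lt_card hEdges).not_ge (hmin E (by simp [hE, hEcard']))

end DomPerfect

theorem theorem9 {V : Type*} [Finite V] (G : SimpleGraph V) :
    DomPerfect.IsDominationPerfect G ↔
      ∀ j : Fin 17, ¬ (DomPerfect.forbidden j).2.IsIndContained G := by
  refine ⟨fun hG j hj => ?_, fun h S => ?_⟩
  · obtain ⟨u, v, huv⟩ := DomPerfect.exists_forbidden_isDominatingEdge j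
    exact DomPerfect.not_isDominationPerfect hj huv
      (DomPerfect.forbidden_noIndepDominatingPair j) hG
  · exact DomPerfect.dominationNumber_eq_of_forall_not_isIndContained
      fun j hj => h j (hj.trans ⟨SimpleGraph.Embedding.induce S⟩)
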